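/- **Setting.** Covariates $x\in\mathbb R^d$ have law $\mu$; write $\tilde x=(1,x)\in\mathbb R^{d+1}$. Let $\psi(a,s)$, $a\in\mathbb R^R$, $s\in S$ ($S$ a metric space), be a family of probability laws on a metrizable response space $\mathcal Y$, such that $(a,s)\mapsto\psi(a,s)$ is a homeomorphism onto its image $\Phi$ for the topology of convergence in distribution. Examples are Gaussian laws ($R=1$, $a$ the mean, $s>0$ the variance) and softmax (logistic) laws on $R+1$ classes ($a$ the logits, $S$ a point). An expert with parameter $\beta=(b_1,\dots,b_R,s)$, $b_r\in\mathbb R^{d+1}$, has the conditional law $\varphi(\cdot|x;\beta)=\psi\big((\tilde x^\top b_r)_{r\le R},s\big)$. For $K\ge1$, the $K$-component mixture of experts (MoE) with parameter $\theta=(\alpha_1,\dots,\alpha_{K-1},\beta_1,\dots,\beta_K)$, $\alpha_k\in\mathbb R^{d+1}$, is $$f(\cdot|x;\theta)=\sum_{k=1}^K\pi_k(x;\alpha)\,\varphi(\cdot|x;\beta_k),\qquad \pi_k(x;\alpha)=\frac{\exp(\tilde x^\top\alpha_k)}{1+\sum_{k'=1}^{K-1}\exp(\tilde x^\top\alpha_{k'})},\quad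 \alpha_K:=0 .$$ **Divergence.** A cost is a function $c:\Phi\times\Phi\to[0,\infty)$ with $c(\varphi_1,\varphi_2)=0$ iff $\varphi_1=\varphi_2$. For MoE models $h=\sum_{\ell=1}^L\hat\pi_\ell(x)\hat\varphi_\ell(\cdot|x)$ and $g=\sum_{k=1}^K\pi_k(x)\varphi_k(\cdot|x)$, the expected transportation divergence is $$\mathcal T_c(h,g)=\int\ \inf_{Q}\ \sum_{\ell=1}^L\sum_{k=1}^K Q_{\ell k}\,c\big(\hat\varphi_\ell(\cdot|x),\varphi_k(\cdot|x)\big)\,d\mu(x)\in[0,\infty],$$ the infimum being over all $Q\in[0,1]^{L\times K}$ with $\sum_kQ_{\ell k}=\hat\pi_\ell(x)$ and $\sum_\ell Q_{\ell k}=\pi_k(x)$. **Assumptions.** * (A1) The data $(x_i,y_i)$, $i\ge1$, are i.i.d.; $x_i$ has law $\mu$ and, given $x_i=x$, $y_i$ has the law $f(\cdot|x;\theta^*)$ with $K$ components. The gating parameters are initialized ($\alpha_K=0$), and the experts of $\theta^*$ are ordered for some strict order $\prec$ on the expert parameters: for $j<k$ one has $\beta\prec\beta'$ for all $(\beta,\beta')$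 in a neighbourhood of $(\beta_j^*,\beta_k^*)$. The law $\mu$ is not concentrated on a finite union of affine hyperplanes of $\mathbb R^d$. * (A2) $c$ is continuous on $\Phi\times\Phi$ for convergence in distribution, and whenever $\varphi_n\to\varphi$ in distribution, with $\varphi_n,\varphi,\varphi'_n\in\Phi$, one has $c(\varphi_n,\varphi'_n)\to0$ iff $\varphi'_n\to\varphi$ in distribution. * (Finite expected costs.) There are a neighbourhood $U$ of $\theta^*$ and a $\mu$-integrable $G$ such that, for $\mu$-almost every $x$, $c(\varphi(\cdot|x;\beta_j),\varphi(\cdot|x;\beta_k^*))\le G(x)$ for all $\theta\in U$ (with experts $\beta_1,\dots,\beta_K$) and all $j,k\le K$. **Estimators.** $M$ is fixed. For each $N$, the first $N$ data are distributed (possibly at random) over $M$ machines: machine $m$ gets a subset of size $N_m$, with $\sum_mN_m=N$. Let $\hat\theta_m$ be an estimator of $\theta^*$ computed from the data of machine $m$, and let $$\bar f^W=\sum_{m=1}^M\frac{N_m}{N}\,f(\cdot|x;\hat\theta_m),$$ regarded as the MoE with the $MK$ gating functions $\frac{N_m}{N}\pi_k(x;\hat\alpha^{(m)})$ and experts $\varphi(\cdot|x;\hat\beta^{(m)}_k)$.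 A reduction estimator $\bar\theta^R$ is a random parameter of a $K$-component MoE such that, with probability tending to one as $N\to\infty$ (for instance, for every $N$), $\bar\theta^R$ minimizes $\theta\mapsto\mathcal T_c\big(\bar f^W,f(\cdot|\cdot;\theta)\big)$ over all parameters $\theta$ of $K$-component MoE models, and its experts are labelled compatibly with $\prec$, i.e. $\bar\beta^R_k\not\prec\bar\beta^R_j$ for $j<k$. **Proposition.** Under these assumptions, if every local estimator is consistent, i.e. $\hat\theta_m\to\theta^*$ in probability as $N\to\infty$ for each $m\le M$, then $\bar\theta^R$ is consistent: $\bar\theta^R\to\theta^*$ in probability as $N\to\infty$, for the gating parameters and the expert parameters jointly. -/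

import Mathlib

open MeasureTheory ProbabilityTheory Filter Topology
open scoped ENNReal NNReal

/-- The softmax function with `n + 1` outputs whose last logit is initialized to zero:
output `i < n` is `exp (a i) / (1 + ∑ k, exp (a k))`, the last one is `1 / (1 + ∑ k, exp (a k))`. -/
noncomputable def softmax {n : ℕ} (a : Fin n → ℝ) (i : Fin (n + 1)) : ℝ :=
  Real.exp (Fin.snoc (α := fun _ => ℝ) a 0 i) / (1 + ∑ k, Real.exp (a k))

/-- The covariate vector `x ∈ ℝᵈ`, augmented to `(1, x) ∈ ℝᵈ⁺¹`. -/
def augment {d : ℕ} (x : Fin d → ℝ) : Fin (d + 1) → ℝ := Fin.cons 1 x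

/-- Parameters of one expert: `R` regression coefficient vectors in `ℝᵈ⁺¹` (one for each linear
predictor) and a dispersion parameter in `S`. For Gaussian experts `R = 1` and `S = (0, ∞)` holds
the variance; for softmax experts with `R + 1` classes `S` is a point. -/
abbrev ExpertParam (d R : ℕ) (S : Type*) := (Fin R → Fin (d + 1) → ℝ) × S

/-- Parameters `θ = (α, β₁, …, β_K)` of a mixture of `K = J + 1` experts. There are `J` gating
vectors: the gating parameter of the last expert is initialized to zero. -/
abbrev MoEParam (d J R : ℕ) (S : Type*) :=
  (Fin J → Fin (d + 1) → ℝ) × (Fin (J + 1) → ExpertParam d R S)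

/-- A mixture-of-experts model with components indexed by `ι`: gating functions and experts. -/
structure MoE (𝓧 𝒴 ι : Type*) [MeasurableSpace 𝒴] where
  /-- the gating functions `x ↦ π_k(x)` -/
  gate : 𝓧 → ι → ℝ
  /-- the experts `x ↦ φ_k(· | x)` -/
  expert : 𝓧 → ι → ProbabilityMeasure 𝒴

/-- The conditional law of the response given `x`, namely `∑ k, π_k(x) φ_k(· | x)`. -/
noncomputable def MoE.condLaw {𝓧 𝒴 ι : Type*} [MeasurableSpace 𝒴] [Fintype ι]
    (g : MoE 𝓧 𝒴 ι) (x : 𝓧) : Measure 𝒴 :=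
  ∑ k, ENNReal.ofReal (g.gate x k) • (g.expert x k : Measure 𝒴)

/-- The mixture of experts with parameter `θ`, built from the expert laws `ψ`: the gating network
is a softmax of `xᵀα_k`, and expert `k` given `x` has the law `ψ` at the linear predictors
`xᵀβ_{k,r}` and the dispersion of expert `k`. -/
noncomputable def moe {d J R : ℕ} {S 𝒴 : Type*} [MeasurableSpace 𝒴]
    (ψ : (Fin R → ℝ) × S → ProbabilityMeasure 𝒴) (θ : MoEParam d J R S) :
    MoE (Fin d → ℝ) 𝒴 (Fin (J + 1)) where
  gate x := softmax fun k => θ.1 k ⬝ᵥ augment x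
  expert x k := ψ (fun r => (θ.2 k).1 r ⬝ᵥ augment x, (θ.2 k).2)

/-- The weighted average `f̄ᵂ = ∑ m, w_m f(· | x; θ_m)` of `M` local models, viewed as a mixture of
experts with `M * K` components: gating functions `w_m π_k(x; α⁽ᵐ⁾)`, experts
`φ(· | x; β_k⁽ᵐ⁾)`. -/
noncomputable def weightedAverage {d J R M : ℕ} {S 𝒴 : Type*} [MeasurableSpace 𝒴]
    (ψ : (Fin R → ℝ) × S → ProbabilityMeasure 𝒴) (w : Fin M → ℝ)
    (θ : Fin M → MoEParam d J R S) : MoE (Fin d → ℝ) 𝒴 (Fin M × Fin (J + 1)) where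
  gate x l := w l.1 * (moe ψ (θ l.1)).gate x l.2
  expert x l := (moe ψ (θ l.1)).expert x l.2

/-- The transportation plans between the weight vectors `a` and `b`. -/
def transportPlans {ι κ : Type*} [Fintype ι] [Fintype κ] (a : ι → ℝ) (b : κ → ℝ) :
    Set (ι → κ → ℝ) :=
  {P | (∀ l k, P l k ∈ Set.Icc (0 : ℝ) 1) ∧ (∀ l, ∑ k, P l k = a l) ∧ ∀ k, ∑ l, P l k = b k}

/-- The optimal transportation cost `𝒯_c(h, g, x)` between the components at `x`. -/
noncomputable def transportDivAt {𝓧 𝒴 ι κ : Type*} [MeasurableSpace 𝒴] [Fintype ι] [Fintype κ]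
    (c : ProbabilityMeasure 𝒴 → ProbabilityMeasure 𝒴 → ℝ) (h : MoE 𝓧 𝒴 ι) (g : MoE 𝓧 𝒴 κ)
    (x : 𝓧) : ℝ≥0∞ :=
  ⨅ P ∈ transportPlans (h.gate x) (g.gate x),
    ENNReal.ofReal (∑ l, ∑ k, P l k * c (h.expert x l) (g.expert x k))

/-- The expected transportation divergence `𝒯_c(h, g) = 𝔼[𝒯_c(h, g, x)]` for covariates with law
`μ`, as an extended nonnegative number. -/
noncomputable def transportDiv {𝓧 𝒴 ι κ : Type*} [MeasurableSpace 𝓧] [MeasurableSpace 𝒴]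
    [Fintype ι] [Fintype κ] (c : ProbabilityMeasure 𝒴 → ProbabilityMeasure 𝒴 → ℝ)
    (μ : Measure 𝓧) (h : MoE 𝓧 𝒴 ι) (g : MoE 𝓧 𝒴 κ) : ℝ≥0∞ :=
  ∫⁻ x, transportDivAt c h g x ∂μ

/-- `c` is a cost function on the family `Φ`: nonnegative, and zero exactly on the diagonal. -/
structure IsCost {𝒴 : Type*} [MeasurableSpace 𝒴] (Φ : Set (ProbabilityMeasure 𝒴))
    (c : ProbabilityMeasure 𝒴 → ProbabilityMeasure 𝒴 → ℝ) : Prop where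
  nonneg : ∀ φ₁ ∈ Φ, ∀ φ₂ ∈ Φ, 0 ≤ c φ₁ φ₂
  eq_zero_iff : ∀ φ₁ ∈ Φ, ∀ φ₂ ∈ Φ, (c φ₁ φ₂ = 0 ↔ φ₁ = φ₂)

/-- The cost is continuous on `Φ × Φ` for convergence in distribution, and vanishes asymptotically
exactly under convergence in distribution: if `u n → φ` in distribution within `Φ`, then
`c (u n) (v n) → 0` if and only if `v n → φ` in distribution. -/
structure IsDistributionallyContinuousCost {𝒴 : Type*} [MeasurableSpace 𝒴] [TopologicalSpace 𝒴]
    [OpensMeasurableSpace 𝒴] (Φ : Set (ProbabilityMeasure 𝒴))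
    (c : ProbabilityMeasure 𝒴 → ProbabilityMeasure 𝒴 → ℝ) : Prop where
  continuousOn : ContinuousOn (fun p : ProbabilityMeasure 𝒴 × ProbabilityMeasure 𝒴 => c p.1 p.2)
    (Φ ×ˢ Φ)
  tendsto_zero_iff : ∀ (u v : ℕ → ProbabilityMeasure 𝒴) (φ : ProbabilityMeasure 𝒴),
    (∀ n, u n ∈ Φ) → (∀ n, v n ∈ Φ) → φ ∈ Φ → Tendsto u atTop (𝓝 φ) →
      (Tendsto (fun n => c (u n) (v n)) atTop (𝓝 0) ↔ Tendsto v atTop (𝓝 φ))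

/-- Expected costs are locally dominated at `θ`: for parameters `θ'` near `θ`, the costs between
the experts of `θ'` and those of `θ` have a common integrable upper bound. -/
def HasIntegrableEnvelope {d J R : ℕ} {S 𝒴 : Type*} [MeasurableSpace 𝒴] [TopologicalSpace S]
    (ψ : (Fin R → ℝ) × S → ProbabilityMeasure 𝒴)
    (c : ProbabilityMeasure 𝒴 → ProbabilityMeasure 𝒴 → ℝ) (μ : Measure (Fin d → ℝ))
    (θ : MoEParam d J R S) : Prop :=
  ∃ U ∈ 𝓝 θ, ∃ G : (Fin d → ℝ) → ℝ, Integrable G μ ∧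
    ∀ᵐ x ∂μ, ∀ θ' ∈ U, ∀ j k, c ((moe ψ θ').expert x j) ((moe ψ θ).expert x k) ≤ G x

/-- The law of the covariates is not concentrated on finitely many (affine) hyperplanes. -/
def NotOnHyperplanes {d : ℕ} (μ : Measure (Fin d → ℝ)) : Prop :=
  ∀ H : Finset (Fin (d + 1) → ℝ), (∀ u ∈ H, u ≠ 0) → ¬ ∀ᵐ x ∂μ, ∃ u ∈ H, u ⬝ᵥ augment x = 0

/-- The experts of the (true) parameter are ordered, `β_j ≺ β_k` for `j < k`, and stay so under
small perturbations. -/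
def IsOrdered {d J R : ℕ} {S : Type*} [TopologicalSpace S]
    (r : ExpertParam d R S → ExpertParam d R S → Prop) (θ : MoEParam d J R S) : Prop :=
  ∀ j k, j < k → ∀ᶠ p in 𝓝 (θ.2 j, θ.2 k), r p.1 p.2

/-- `θ` is a reduction parameter for the model `h`: its model minimizes the expected transportation
divergence from `h` among all `(J + 1)`-component models, and its experts are labelled in an order
compatible with `≺` (no expert strictly precedes one with a smaller label). -/
def IsReduction {d J R : ℕ} {S 𝒴 ι : Type*} [MeasurableSpace 𝒴] [Fintype ι]
    (ψ : (Fin R → ℝ) × S → ProbabilityMeasure 𝒴)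
    (c : ProbabilityMeasure 𝒴 → ProbabilityMeasure 𝒴 → ℝ) (μ : Measure (Fin d → ℝ))
    (r : ExpertParam d R S → ExpertParam d R S → Prop) (h : MoE (Fin d → ℝ) 𝒴 ι)
    (θ : MoEParam d J R S) : Prop :=
  (∀ θ' : MoEParam d J R S, transportDiv c μ h (moe ψ θ) ≤ transportDiv c μ h (moe ψ θ')) ∧
    ∀ j k, j < k → ¬ r (θ.2 k) (θ.2 j)

/-! The two standard families of experts. -/

/-- Gaussian experts: the linear predictor is the mean, the dispersion is the variance. -/
noncomputable def gaussianExpert (a : (Fin 1 → ℝ) × Set.Ioi (0 : ℝ)) : ProbabilityMeasure ℝ :=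
  ⟨gaussianReal (a.1 0) (a.2 : ℝ).toNNReal, inferInstance⟩

theorem softmax_sum {n : ℕ} (a : Fin n → ℝ) : ∑ i, softmax a i = 1 := by
  have h : 0 < 1 + ∑ k, Real.exp (a k) := by positivity
  simp only [softmax, ← Finset.sum_div, Fin.sum_univ_castSucc, Fin.snoc_castSucc, Fin.snoc_last,
    Real.exp_zero]
  rw [div_eq_one_iff_eq h.ne', add_comm]

theorem softmax_pos {n : ℕ} (a : Fin n → ℝ) (i : Fin (n + 1)) : 0 < softmax a i := by
  unfold softmax; positivity

/-- Softmax experts for classification with `R + 1` classes (logistic experts for `R = 1`). -/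
noncomputable def softmaxExpert {R : ℕ} (a : (Fin R → ℝ) × Unit) :
    ProbabilityMeasure (Fin (R + 1)) :=
  ⟨∑ i, ENNReal.ofReal (softmax a.1 i) • Measure.dirac i, ⟨by
    simp [Measure.finsetSum_apply,
      ← ENNReal.ofReal_sum_of_nonneg fun i _ => (softmax_pos a.1 i).le, softmax_sum]⟩⟩

theorem isEmbedding_of_comap_nhds_le {A B : Type*} [TopologicalSpace A] [T1Space A]
    [TopologicalSpace B] {f : A → B} (hf : Continuous f)
    (h : ∀ a, Filter.comap f (𝓝 (f a)) ≤ 𝓝 a) : IsEmbedding f := by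
  refine ⟨isInducing_iff_nhds.2 fun a => le_antisymm (hf.tendsto a).le_comap (h a), ?_⟩
  intro a b hab
  have h1 : pure b ≤ Filter.comap f (𝓝 (f a)) := by
    rw [hab]; exact (pure_le_nhds b).trans (hf.tendsto b).le_comap
  exact (pure_le_nhds_iff.1 (h1.trans (h a))).symm

theorem gaussianReal_real_Ioi_self (m : ℝ) {v : ℝ≥0} (hv : v ≠ 0) :
    (gaussianReal m v).real (Set.Ioi m) = 1 / 2 := by
  have : NullSingletonClass (gaussianReal m v) := nullSingletonClass_gaussianReal hv
  have h1 : (gaussianReal m v).map (fun x => 2 * m - x) = gaussianReal m v := by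
    rw [gaussianReal_map_const_sub]; congr 1; ring
  have h2 : (gaussianReal m v).real (Set.Ioi m) = (gaussianReal m v).real (Set.Iio m) := by
    conv_lhs => rw [← h1]
    rw [map_measureReal_apply (by fun_prop) measurableSet_Ioi]
    congr 1; ext x; simp only [Set.mem_preimage, Set.mem_Ioi, Set.mem_Iio]
    constructor <;> intro h <;> linarith
  have h3 := probReal_compl_eq_one_sub (μ := gaussianReal m v) (measurableSet_Ioi (a := m))
  rw [Set.compl_Ioi] at h3
  have h4 : (gaussianReal m v).real (Set.Iic m) = (gaussianReal m v).real (Set.Iio m) :=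
    measureReal_congr Iio_ae_eq_Iic.symm
  linarith

theorem half_lt_gaussianReal_Ioi_iff {m a : ℝ} {v : ℝ≥0} (hv : v ≠ 0) :
    1 / 2 < (gaussianReal m v).real (Set.Ioi a) ↔ a < m := by
  rw [← gaussianReal_real_Ioi_self m hv]
  constructor
  · intro h
    by_contra! hle
    exact absurd (measureReal_mono (μ := gaussianReal m v) (Set.Ioi_subset_Ioi hle)) h.not_ge
  · intro h
    rw [← Set.Ioc_union_Ioi_eq_Ioi h.le, measureReal_union (Set.Ioc_disjoint_Ioi le_rfl)
      measurableSet_Ioi]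
    have : 0 < (gaussianReal m v).real (Set.Ioc a m) := by
      refine ENNReal.toReal_pos (fun h0 => ?_) (measure_ne_top _ _)
      have := gaussianReal_absolutelyContinuous' m hv h0
      simp [h.not_ge] at this
    linarith

theorem gaussianExpert_tendsto_charFun {F : Filter ((Fin 1 → ℝ) × Set.Ioi (0 : ℝ))}
    {a : (Fin 1 → ℝ) × Set.Ioi (0 : ℝ)}
    (h : Tendsto gaussianExpert F (𝓝 (gaussianExpert a))) :
    Tendsto (fun b => charFun (gaussianExpert b : Measure ℝ) 1) F
      (𝓝 (charFun (gaussianExpert a : Measure ℝ) 1)) := by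
  rw [ProbabilityMeasure.tendsto_iff_forall_integral_rclike_tendsto ℂ] at h
  simp_rw [charFun_eq_integral_innerProbChar]
  exact h _

/-- The Gaussian law depends homeomorphically on its mean and variance. -/
theorem gaussianExpert_isEmbedding : IsEmbedding gaussianExpert := by
  refine isEmbedding_of_comap_nhds_le ?_ ?_
  · refine SeqContinuous.continuous fun u a hu => ?_
    refine (ProbabilityMeasure.tendsto_iff_tendsto_charFun (μ := fun n => gaussianExpert (u n))).2
      fun t => ?_
    simp only [gaussianExpert, ProbabilityMeasure.coe_mk, charFun_gaussianReal]
    have h1 : Continuous fun b : (Fin 1 → ℝ) × Set.Ioi (0 : ℝ) =>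
      Complex.exp (t * (b.1 0 : ℝ) * Complex.I - ((b.2 : ℝ).toNNReal : ℝ) * t ^ 2 / 2) := by
      fun_prop
    exact (h1.tendsto a).comp hu
  · intro a
    have hT : Tendsto gaussianExpert (Filter.comap gaussianExpert (𝓝 (gaussianExpert a)))
      (𝓝 (gaussianExpert a)) := tendsto_comap
    generalize Filter.comap gaussianExpert (𝓝 (gaussianExpert a)) = F at hT
    have hv : ∀ b : (Fin 1 → ℝ) × Set.Ioi (0 : ℝ), (b.2 : ℝ).toNNReal ≠ 0 := fun b => by
      exact (Real.toNNReal_pos.2 b.2.2).ne'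
    have hnorm : ∀ b, -2 * Real.log ‖charFun (gaussianExpert b : Measure ℝ) 1‖ = b.2 := by
      intro b
      have hb : (0 : ℝ) < b.2 := b.2.2
      simp [gaussianExpert, charFun_gaussianReal, Complex.norm_exp, hb.le]
      ring
    have hmean : ∀ b s, 1 / 2 < (gaussianExpert b : Measure ℝ) (Set.Ioi s) ↔ s < b.1 0 := by
      intro b s
      rw [← half_lt_gaussianReal_Ioi_iff (hv b), Measure.real,
        ← ENNReal.toReal_lt_toReal (by simp) (measure_ne_top _ _)]
      simp [gaussianExpert]
    have hmean' : ∀ b s, 1 / 2 < (gaussianExpert b : Measure ℝ) (Set.Iio s) ↔ b.1 0 < s := by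
      intro b s
      have h1 : (gaussianReal (b.1 0) (b.2 : ℝ).toNNReal) (Set.Iio s) =
          (gaussianReal (-b.1 0) (b.2 : ℝ).toNNReal) (Set.Ioi (-s)) := by
        rw [← gaussianReal_map_neg, Measure.map_apply (by fun_prop) measurableSet_Ioi]
        congr 1; ext x; simp
      rw [← neg_lt_neg_iff (a := s), ← half_lt_gaussianReal_Ioi_iff (hv b), Measure.real, ← h1,
        ← ENNReal.toReal_lt_toReal (by simp) (measure_ne_top _ _)]
      simp [gaussianExpert]
    have key : ∀ G : Set ℝ, IsOpen G → 1 / 2 < (gaussianExpert a : Measure ℝ) G →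
        ∀ᶠ b in F, 1 / 2 < (gaussianExpert b : Measure ℝ) G := fun G hG h =>
      eventually_lt_of_lt_liminf
        (h.trans_le (ProbabilityMeasure.le_liminf_measure_open_of_tendsto hT hG))
    have h1 : Tendsto (fun b : (Fin 1 → ℝ) × Set.Ioi (0 : ℝ) => b.1 0) F (𝓝 (a.1 0)) := by
      refine tendsto_order.2 ⟨fun s hs => ?_, fun s hs => ?_⟩
      · simpa only [hmean] using key _ isOpen_Ioi ((hmean a s).2 hs)
      · simpa only [hmean'] using key _ isOpen_Iio ((hmean' a s).2 hs)
    have h2 : Tendsto (fun b : (Fin 1 → ℝ) × Set.Ioi (0 : ℝ) => (b.2 : ℝ)) F (𝓝 a.2) := by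
      have hne : ‖charFun (gaussianExpert a : Measure ℝ) 1‖ ≠ 0 := by
        simp [gaussianExpert, charFun_gaussianReal]
      have := ((gaussianExpert_tendsto_charFun hT).norm.log hne).const_mul (-2)
      simpa only [hnorm] using this
    have h3 : Tendsto (fun b : (Fin 1 → ℝ) × Set.Ioi (0 : ℝ) => b.2) F (𝓝 a.2) := by
      rw [tendsto_subtype_rng]; exact h2
    have h4 : Tendsto (fun b : (Fin 1 → ℝ) × Set.Ioi (0 : ℝ) => b.1) F (𝓝 a.1) := by
      refine tendsto_pi_nhds.2 fun i => ?_
      rw [Subsingleton.elim i 0]; exact h1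
    exact h4.prodMk_nhds h3

theorem integral_softmaxExpert {R : ℕ} (a : (Fin R → ℝ) × Unit) (f : Fin (R + 1) → ℝ) :
    ∫ y, f y ∂(softmaxExpert a : Measure (Fin (R + 1))) = ∑ i, softmax a.1 i * f i := by
  simp only [softmaxExpert, ProbabilityMeasure.coe_mk]
  have hfin : ∀ i, IsFiniteMeasure (ENNReal.ofReal (softmax a.1 i) • Measure.dirac i) :=
    fun i => Measure.smul_finite _ ENNReal.ofReal_ne_top
  rw [integral_finsetSum_measure fun i _ => Integrable.of_finite]
  simp [integral_smul_measure, (softmax_pos _ _).le]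

/-- The softmax law depends homeomorphically on its logits. -/
theorem softmaxExpert_isEmbedding {R : ℕ} : IsEmbedding (softmaxExpert (R := R)) := by
  refine isEmbedding_of_comap_nhds_le ?_ ?_
  · refine continuous_iff_continuousAt.2 fun a =>
      ProbabilityMeasure.tendsto_iff_forall_integral_tendsto.2 fun f => ?_
    simp only [integral_softmaxExpert]
    refine Continuous.tendsto (continuous_finsetSum _ fun i _ => Continuous.mul ?_ (by fun_prop)) a
    unfold softmax
    refine Continuous.div ?_ (by fun_prop) fun b => ?_
    · refine Real.continuous_exp.comp ?_
      refine Fin.lastCases ?_ (fun j => ?_) i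
      · simpa using continuous_const
      · simp only [Fin.snoc_castSucc]; fun_prop
    · have : 0 < 1 + ∑ k, Real.exp (b.1 k) := by positivity
      exact this.ne'
  · intro a
    have hT : Tendsto softmaxExpert (Filter.comap softmaxExpert (𝓝 (softmaxExpert a)))
      (𝓝 (softmaxExpert a)) := tendsto_comap
    generalize Filter.comap softmaxExpert (𝓝 (softmaxExpert a)) = F at hT
    have hS : ∀ i, Tendsto (fun b : (Fin R → ℝ) × Unit => softmax b.1 i) F
        (𝓝 (softmax a.1 i)) := by
      intro i
      have := ProbabilityMeasure.tendsto_iff_forall_integral_tendsto.1 hT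
        (BoundedContinuousFunction.mkOfCompact ⟨Pi.single i 1, continuous_of_discreteTopology⟩)
      simpa [integral_softmaxExpert, Pi.single_apply] using this
    have hlog : ∀ (b : (Fin R → ℝ) × Unit) (i : Fin R),
        Real.log (softmax b.1 i.castSucc / softmax b.1 (Fin.last R)) = b.1 i := by
      intro b i
      have h : (1 + ∑ k, Real.exp (b.1 k)) ≠ 0 := by positivity
      rw [softmax, softmax, div_div_div_cancel_right₀ h]
      simp
    have h4 : Tendsto (fun b : (Fin R → ℝ) × Unit => b.1) F (𝓝 a.1) := by
      refine tendsto_pi_nhds.2 fun i => ?_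
      have := ((hS i.castSucc).div (hS (Fin.last R)) (softmax_pos _ _).ne').log
        (div_pos (softmax_pos _ _) (softmax_pos _ _)).ne'
      simpa only [Pi.div_apply, hlog] using this
    exact h4.prodMk_nhds (tendsto_const_nhds (x := ()))

/-! The core is deterministic: `exists_forall_isReduction_edist_lt` says that reductions of averages
of models close to `θstar` are close to `θstar`, uniformly in the weights. Consistency follows by a
union bound.

If this failed, there would be local parameters converging to `θstar` whose reductions `η n` stay
away from it. Coupling each local model with `θstar` label by label and using dominated convergence,
the divergence from the average to `θstar` vanishes (`tendsto_transportDiv_weightedAverage`). By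
minimality so does the divergence to `η n`, and along a subsequence these divergences are summable,
so transport costs vanish at almost every `x`.

At such an `x`, mass in excess of what the targets in `t` can hold must pay to leave `t`. With `t =
∅`, every true expert is approached by experts of `η n`; with `t = {k}`, once the experts converge
to distinct laws, the gates converge.

An ultrafilter freezes the labels in `n`. Since `μ` does not live on finitely many hyperplanes, one
relabelling `σ` serves enough covariates to determine linear forms. No compactness of the parameters
is needed: the embedding `ψ` turns convergence of laws into convergence of predictors, hence of
coefficients. The order forces `σ = id`, and log-ratios of gates yield the gating parameters. -/

/-! ### Discrete transport: an efficient coupling and a lower bound -/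

/-- Two weight vectors of total mass one have a coupling whose off-diagonal entries are bounded by
the differences of the weights. -/
theorem exists_transportPlan_offDiag_le {ι : Type*} [Fintype ι] [DecidableEq ι] {a b : ι → ℝ}
    (ha : ∀ i, 0 ≤ a i) (hb : ∀ i, 0 ≤ b i) (ha1 : ∑ i, a i = 1) (hb1 : ∑ i, b i = 1) :
    ∃ Q ∈ transportPlans a b, ∀ i j, i ≠ j → Q i j ≤ |a i - b i| := by
  set m : ι → ℝ := fun i => min (a i) (b i) with hm
  set D : ℝ := 1 - ∑ i, m i with hD
  have hma : ∀ i, 0 ≤ a i - m i := fun i => sub_nonneg.2 (min_le_left _ _)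
  have hmb : ∀ i, 0 ≤ b i - m i := fun i => sub_nonneg.2 (min_le_right _ _)
  have hm0 : ∀ i, 0 ≤ m i := fun i => le_min (ha i) (hb i)
  have hDa : ∑ i, (a i - m i) = D := by rw [Finset.sum_sub_distrib, ha1]
  have hDb : ∑ i, (b i - m i) = D := by rw [Finset.sum_sub_distrib, hb1]
  have hD0 : 0 ≤ D := hDa ▸ Finset.sum_nonneg fun i _ => hma i
  have hleb : ∀ i, b i - m i ≤ D := fun i =>
    hDb ▸ Finset.single_le_sum (f := fun i => b i - m i) (fun j _ => hmb j) (Finset.mem_univ i)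
  have hlea : ∀ i, a i - m i ≤ D := fun i =>
    hDa ▸ Finset.single_le_sum (f := fun i => a i - m i) (fun j _ => hma j) (Finset.mem_univ i)
  -- If `D = 0`, then `t = 0` as well, and the convention `0 / 0 = 0` gives the right value.
  have hcancel : ∀ t, 0 ≤ t → t ≤ D → t * D / D = t := by
    intro t h0 h1
    rcases hD0.eq_or_lt with h | h
    · simp [← h] at h1 ⊢; linarith
    · field_simp
  -- The common mass `m` stays on the diagonal; the leftovers `a - m` and `b - m`, both of total
  -- mass `D`, are coupled by their normalized product.
  set Q : ι → ι → ℝ := fun i j => (if i = j then m i else 0) + (a i - m i) * (b j - m j) / D with hQ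
  have hQ0 : ∀ i j, 0 ≤ Q i j := fun i j => by
    have h1 : 0 ≤ (a i - m i) * (b j - m j) / D :=
      div_nonneg (mul_nonneg (hma i) (hmb j)) hD0
    have h2 : 0 ≤ if i = j then m i else 0 := by split_ifs <;> simp [hm0]
    exact add_nonneg h2 h1
  have hrow : ∀ i, ∑ j, Q i j = a i := fun i => by
    simp only [hQ, Finset.sum_add_distrib, ← Finset.sum_div, ← Finset.mul_sum, hDb]
    rw [hcancel _ (hma i) (hlea i)]
    simp
  have hcol : ∀ j, ∑ i, Q i j = b j := fun j => by
    simp only [hQ, Finset.sum_add_distrib, ← Finset.sum_div, ← Finset.sum_mul, hDa]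
    rw [mul_comm D, hcancel _ (hmb j) (hleb j)]
    simp
  refine ⟨Q, ⟨fun i j => ⟨hQ0 i j, ?_⟩, hrow, hcol⟩, fun i j hij => ?_⟩
  · calc Q i j ≤ ∑ j, Q i j := Finset.single_le_sum (fun j _ => hQ0 i j) (Finset.mem_univ j)
      _ = a i := hrow i
      _ ≤ ∑ i, a i := Finset.single_le_sum (fun i _ => ha i) (Finset.mem_univ i)
      _ = 1 := ha1
  · have h1 : Q i j ≤ a i - m i := by
      simp only [hQ, if_neg hij, zero_add]
      have := hma i
      have := hleb j
      conv_rhs => rw [← hcancel _ (hma i) (hlea i)]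
      gcongr
    refine h1.trans ?_
    rcases le_total (a i) (b i) with h | h
    · simp [hm, min_eq_left h]
    · simpa [hm, min_eq_right h] using le_abs_self (a i - b i)

/-- The optimal transportation cost dominates the cost of moving the mass of a set of sources that
does not fit into a given set of targets. -/
theorem ofReal_excess_mul_inf_le_transportDivAt {𝓧 𝒴 ι κ : Type*} [MeasurableSpace 𝒴]
    [Fintype ι] [Fintype κ] [DecidableEq κ]
    {c : ProbabilityMeasure 𝒴 → ProbabilityMeasure 𝒴 → ℝ} {h : MoE 𝓧 𝒴 ι} {g : MoE 𝓧 𝒴 κ} {x : 𝓧}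
    (hc : ∀ l k, 0 ≤ c (h.expert x l) (g.expert x k)) (s : Finset ι) (t : Finset κ) :
    ENNReal.ofReal (∑ l ∈ s, h.gate x l - ∑ k ∈ t, g.gate x k) *
      (s ×ˢ tᶜ).inf (fun p => ENNReal.ofReal (c (h.expert x p.1) (g.expert x p.2))) ≤
      transportDivAt c h g x := by
  refine le_iInf₂ fun Q hQ => ?_
  obtain ⟨h01, hrow, hcol⟩ := hQ
  have h0 : ∀ l k, 0 ≤ Q l k := fun l k => (h01 l k).1
  set δ := (s ×ˢ tᶜ).inf fun p => ENNReal.ofReal (c (h.expert x p.1) (g.expert x p.2)) with hδ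
  -- The targets in `t` absorb no more than their own mass. If `s` or `tᶜ` is empty, the infimum `δ`
  -- is `∞`, but this bound makes the excess nonpositive and the product `0`.
  have hmass : ∑ l ∈ s, h.gate x l - ∑ k ∈ t, g.gate x k ≤ ∑ l ∈ s, ∑ k ∈ tᶜ, Q l k := by
    have h1 : ∑ l ∈ s, h.gate x l = ∑ l ∈ s, ∑ k ∈ t, Q l k + ∑ l ∈ s, ∑ k ∈ tᶜ, Q l k := by
      rw [← Finset.sum_add_distrib]
      exact Finset.sum_congr rfl fun l _ => by rw [← hrow l, Finset.sum_add_sum_compl]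
    have h2 : ∑ l ∈ s, ∑ k ∈ t, Q l k ≤ ∑ k ∈ t, g.gate x k := by
      rw [Finset.sum_comm]
      exact Finset.sum_le_sum fun k _ => hcol k ▸
        Finset.sum_le_sum_of_subset_of_nonneg (Finset.subset_univ s) fun l _ _ => h0 l k
    linarith
  calc _ ≤ ENNReal.ofReal (∑ l ∈ s, ∑ k ∈ tᶜ, Q l k) * δ := by gcongr
    _ = ∑ l ∈ s, ∑ k ∈ tᶜ, ENNReal.ofReal (Q l k) * δ := by
      rw [ENNReal.ofReal_sum_of_nonneg fun l _ => Finset.sum_nonneg fun k _ => h0 l k,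
        Finset.sum_mul]
      refine Finset.sum_congr rfl fun l _ => ?_
      rw [ENNReal.ofReal_sum_of_nonneg fun k _ => h0 l k, Finset.sum_mul]
    _ ≤ ∑ l ∈ s, ∑ k ∈ tᶜ, ENNReal.ofReal (Q l k) *
          ENNReal.ofReal (c (h.expert x l) (g.expert x k)) := by
      refine Finset.sum_le_sum fun l hl => Finset.sum_le_sum fun k hk => ?_
      gcongr
      exact Finset.inf_le (f := fun p : ι × κ => ENNReal.ofReal (c (h.expert x p.1) (g.expert x p.2)))
        (Finset.mk_mem_product hl hk)
    _ = ENNReal.ofReal (∑ l ∈ s, ∑ k ∈ tᶜ, Q l k * c (h.expert x l) (g.expert x k)) := by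
      have h2 : ∀ l k, 0 ≤ Q l k * c (h.expert x l) (g.expert x k) := fun l k =>
        mul_nonneg (h0 l k) (hc l k)
      rw [ENNReal.ofReal_sum_of_nonneg fun l _ => Finset.sum_nonneg fun k _ => h2 l k]
      refine Finset.sum_congr rfl fun l _ => ?_
      rw [ENNReal.ofReal_sum_of_nonneg fun k _ => h2 l k]
      exact Finset.sum_congr rfl fun k _ => (ENNReal.ofReal_mul (h0 l k)).symm
    _ ≤ _ := by
      have h2 : ∀ l k, 0 ≤ Q l k * c (h.expert x l) (g.expert x k) := fun l k =>
        mul_nonneg (h0 l k) (hc l k)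
      refine ENNReal.ofReal_le_ofReal ?_
      refine (Finset.sum_le_sum fun l _ => Finset.sum_le_sum_of_subset_of_nonneg
        (Finset.subset_univ _) fun k _ _ => h2 l k).trans ?_
      exact Finset.sum_le_sum_of_subset_of_nonneg (Finset.subset_univ _) fun l _ _ =>
        Finset.sum_nonneg fun k _ => h2 l k

/-! ### Continuity of the model and recovery of linear parameters -/

theorem continuous_softmax {n : ℕ} (i : Fin (n + 1)) :
    Continuous fun a : Fin n → ℝ => softmax a i := by
  unfold softmax
  refine Continuous.div ?_ (by fun_prop) fun b => ?_
  · refine Real.continuous_exp.comp ?_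
    refine Fin.lastCases ?_ (fun j => ?_) i
    · simpa using continuous_const
    · simp only [Fin.snoc_castSucc]; fun_prop
  · have : 0 < 1 + ∑ k, Real.exp (b k) := by positivity
    exact this.ne'

/-- The common denominator cancels and the last logit is `0`. This inverts the gating map, so
convergence of gates yields convergence of logits. -/
theorem log_softmax_div {n : ℕ} (a : Fin n → ℝ) (i : Fin n) :
    Real.log (softmax a i.castSucc / softmax a (Fin.last n)) = a i := by
  have h : (1 + ∑ k, Real.exp (a k)) ≠ 0 := by positivity
  rw [softmax, softmax, div_div_div_cancel_right₀ h]
  simp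

theorem continuous_augment {d : ℕ} : Continuous (augment (d := d)) := by
  refine continuous_pi fun i => ?_
  refine Fin.cases ?_ (fun j => ?_) i
  · simpa [augment] using continuous_const
  · simpa [augment] using continuous_apply j

section moe

variable {d J R : ℕ} {S 𝒴 : Type*} [TopologicalSpace S] [MeasurableSpace 𝒴]
  {ψ : (Fin R → ℝ) × S → ProbabilityMeasure 𝒴}

theorem continuous_moe_gate (k : Fin (J + 1)) :
    Continuous fun p : MoEParam d J R S × (Fin d → ℝ) => (moe ψ p.1).gate p.2 k := by
  refine (continuous_softmax k).comp (continuous_pi fun i => ?_)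
  exact Continuous.dotProduct (by fun_prop) (continuous_augment.comp continuous_snd)

theorem continuous_moe_expert [TopologicalSpace 𝒴] [OpensMeasurableSpace 𝒴] (hψ : Continuous ψ)
    (k : Fin (J + 1)) :
    Continuous fun p : MoEParam d J R S × (Fin d → ℝ) => (moe ψ p.1).expert p.2 k := by
  refine hψ.comp (Continuous.prodMk (continuous_pi fun i => ?_) (by fun_prop))
  exact Continuous.dotProduct (by fun_prop) (continuous_augment.comp continuous_snd)

theorem moe_expert_mem_range {S : Type*} {ψ : (Fin R → ℝ) × S → ProbabilityMeasure 𝒴} (θ : MoEParam d J R S) (x : Fin d → ℝ) (k : Fin (J + 1)) :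
    (moe ψ θ).expert x k ∈ Set.range ψ := Set.mem_range_self _

theorem moe_gate_pos {S : Type*} {ψ : (Fin R → ℝ) × S → ProbabilityMeasure 𝒴}
    (θ : MoEParam d J R S) (x : Fin d → ℝ) (k : Fin (J + 1)) :
    0 < (moe ψ θ).gate x k := softmax_pos _ _

end moe

/-- Linear forms that converge at points `(1, x)` not contained in a linear hyperplane converge. -/
theorem tendsto_of_tendsto_dotProduct_augment {d : ℕ} {ι : Type*} {E : Set (Fin d → ℝ)}
    (hE : ∀ u : Fin (d + 1) → ℝ, u ≠ 0 → ∃ x ∈ E, u ⬝ᵥ augment x ≠ 0) {F : Filter ι}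
    {b : ι → Fin (d + 1) → ℝ} {b' : Fin (d + 1) → ℝ}
    (h : ∀ x ∈ E, Tendsto (fun n => b n ⬝ᵥ augment x) F (𝓝 (b' ⬝ᵥ augment x))) :
    Tendsto b F (𝓝 b') := by
  -- A proper span would be killed by a nonzero functional, contrary to `hE`. Convergence of
  -- pairings then extends by linearity to all vectors, in particular to the coordinate vectors.
  have hspan : Submodule.span ℝ (augment '' E) = ⊤ := by
    by_contra hne
    obtain ⟨f, hf0, hf⟩ := Submodule.exists_le_ker_of_lt_top _ (lt_top_iff_ne_top.2 hne)
    have hfu : ∀ v, f v = (fun i => f (Pi.single i 1)) ⬝ᵥ v := by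
      intro v
      rw [LinearMap.pi_apply_eq_sum_univ f v, dotProduct]
      refine Finset.sum_congr rfl fun i _ => ?_
      rw [smul_eq_mul, mul_comm]
      congr 2
      ext j
      simp [Pi.single_apply, eq_comm]
    obtain ⟨x, hx, hxu⟩ := hE (fun i => f (Pi.single i 1)) fun h0 => hf0 (by
      ext v
      simpa using congrFun h0 v)
    exact hxu (by rw [← hfu]; exact hf (Submodule.subset_span ⟨x, hx, rfl⟩))
  have hall : ∀ v, Tendsto (fun n => b n ⬝ᵥ v) F (𝓝 (b' ⬝ᵥ v)) := by
    intro v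
    have hv : v ∈ Submodule.span ℝ (augment '' E) := hspan ▸ Submodule.mem_top
    induction hv using Submodule.span_induction with
    | mem v hv => obtain ⟨x, hx, rfl⟩ := hv; exact h x hx
    | zero => simpa using tendsto_const_nhds
    | add u v _ _ hu hv => simpa only [dotProduct_add] using hu.add hv
    | smul t v _ hv => simpa only [dotProduct_smul] using hv.const_smul t
  refine tendsto_pi_nhds.2 fun i => ?_
  simpa using hall (Pi.single i 1)

/-! ### Upper bound: averages of converging models approach the limit model -/

/-- Costs between continuously varying members of the family vary continuously. -/
theorem IsDistributionallyContinuousCost.continuous_comp {𝒴 Z : Type*} [MeasurableSpace 𝒴]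
    [TopologicalSpace 𝒴] [OpensMeasurableSpace 𝒴] [TopologicalSpace Z]
    {Φ : Set (ProbabilityMeasure 𝒴)} {c : ProbabilityMeasure 𝒴 → ProbabilityMeasure 𝒴 → ℝ}
    (hc : IsDistributionallyContinuousCost Φ c) {f g : Z → ProbabilityMeasure 𝒴}
    (hf : Continuous f) (hg : Continuous g) (hfΦ : ∀ z, f z ∈ Φ) (hgΦ : ∀ z, g z ∈ Φ) :
    Continuous fun z => c (f z) (g z) :=
  hc.continuousOn.comp_continuous (hf.prodMk hg) fun z => ⟨hfΦ z, hgΦ z⟩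

/-- Costs converge along convergent members of the family. -/
theorem IsDistributionallyContinuousCost.tendsto {𝒴 Z : Type*} [MeasurableSpace 𝒴]
    [TopologicalSpace 𝒴] [OpensMeasurableSpace 𝒴]
    {Φ : Set (ProbabilityMeasure 𝒴)} {c : ProbabilityMeasure 𝒴 → ProbabilityMeasure 𝒴 → ℝ}
    (hc : IsDistributionallyContinuousCost Φ c) {F : Filter Z} {f g : Z → ProbabilityMeasure 𝒴}
    {φ₁ φ₂ : ProbabilityMeasure 𝒴} (hfΦ : ∀ z, f z ∈ Φ) (hgΦ : ∀ z, g z ∈ Φ)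
    (h1 : φ₁ ∈ Φ) (h2 : φ₂ ∈ Φ) (hf : Tendsto f F (𝓝 φ₁)) (hg : Tendsto g F (𝓝 φ₂)) :
    Tendsto (fun z => c (f z) (g z)) F (𝓝 (c φ₁ φ₂)) :=
  (hc.continuousOn (φ₁, φ₂) ⟨h1, h2⟩).tendsto.comp
    (tendsto_nhdsWithin_iff.2 ⟨hf.prodMk_nhds hg, .of_forall fun z => ⟨hfΦ z, hgΦ z⟩⟩)

/-- An upper bound for the cost of transporting one mixture of experts to another one with the same
number of components, when as much mass as possible stays within the components. -/
noncomputable def couplingBound {d J R : ℕ} {S 𝒴 : Type*} [MeasurableSpace 𝒴]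
    (ψ : (Fin R → ℝ) × S → ProbabilityMeasure 𝒴)
    (c : ProbabilityMeasure 𝒴 → ProbabilityMeasure 𝒴 → ℝ) (θ θ' : MoEParam d J R S)
    (x : Fin d → ℝ) : ℝ :=
  ∑ k, (c ((moe ψ θ).expert x k) ((moe ψ θ').expert x k) +
    ∑ j, |(moe ψ θ).gate x k - (moe ψ θ').gate x k| *
      c ((moe ψ θ).expert x k) ((moe ψ θ').expert x j))

section

variable {d J R M : ℕ} {S 𝒴 : Type*} [MeasurableSpace 𝒴]
  {ψ : (Fin R → ℝ) × S → ProbabilityMeasure 𝒴}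
  {c : ProbabilityMeasure 𝒴 → ProbabilityMeasure 𝒴 → ℝ}

theorem moe_gate_sum (θ : MoEParam d J R S) (x : Fin d → ℝ) : ∑ k, (moe ψ θ).gate x k = 1 :=
  softmax_sum _

theorem moe_gate_le_one (θ : MoEParam d J R S) (x : Fin d → ℝ) (k : Fin (J + 1)) :
    (moe ψ θ).gate x k ≤ 1 :=
  moe_gate_sum (ψ := ψ) θ x ▸ Finset.single_le_sum (f := fun k => (moe ψ θ).gate x k)
    (fun j _ => (moe_gate_pos θ x j).le) (Finset.mem_univ k)

theorem couplingBound_nonneg (hc : IsCost (Set.range ψ) c) (θ θ' : MoEParam d J R S)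
    (x : Fin d → ℝ) : 0 ≤ couplingBound ψ c θ θ' x :=
  Finset.sum_nonneg fun _ _ => add_nonneg
    (hc.nonneg _ (moe_expert_mem_range _ _ _) _ (moe_expert_mem_range _ _ _))
    (Finset.sum_nonneg fun _ _ => mul_nonneg (abs_nonneg _)
      (hc.nonneg _ (moe_expert_mem_range _ _ _) _ (moe_expert_mem_range _ _ _)))

theorem couplingBound_self (hc : IsCost (Set.range ψ) c) (θ : MoEParam d J R S) (x : Fin d → ℝ) :
    couplingBound ψ c θ θ x = 0 := by
  refine Finset.sum_eq_zero fun k _ => ?_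
  simp only [sub_self, abs_zero, zero_mul, Finset.sum_const_zero, add_zero]
  exact (hc.eq_zero_iff _ (moe_expert_mem_range _ _ _) _ (moe_expert_mem_range _ _ _)).2 rfl

/-- Each local model is coupled with the target separately, and the plans are mixed with the weights
`w`. Bounding each weight by `1` makes the estimate independent of `w`, so the weights need not
converge. -/
theorem transportDivAt_weightedAverage_le (hc : IsCost (Set.range ψ) c) {w : Fin M → ℝ}
    (hw : ∀ m, 0 ≤ w m) (hw1 : ∑ m, w m = 1) (θ : Fin M → MoEParam d J R S)
    (θ' : MoEParam d J R S) (x : Fin d → ℝ) :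
    transportDivAt c (weightedAverage ψ w θ) (moe ψ θ') x ≤
      ENNReal.ofReal (∑ m, couplingBound ψ c (θ m) θ' x) := by
  have hcn : ∀ m k j, 0 ≤ c ((moe ψ (θ m)).expert x k) ((moe ψ θ').expert x j) := fun m k j =>
    hc.nonneg _ (moe_expert_mem_range _ _ _) _ (moe_expert_mem_range _ _ _)
  have hwle : ∀ m, w m ≤ 1 := fun m =>
    hw1 ▸ Finset.single_le_sum (fun j _ => hw j) (Finset.mem_univ m)
  choose Q hQ hQoff using fun m => exists_transportPlan_offDiag_le
    (a := (moe ψ (θ m)).gate x) (b := (moe ψ θ').gate x) (fun i => (moe_gate_pos _ _ _).le)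
    (fun i => (moe_gate_pos _ _ _).le) (moe_gate_sum _ _) (moe_gate_sum _ _)
  have hplan : (fun l k => w l.1 * Q l.1 l.2 k) ∈
      transportPlans ((weightedAverage ψ w θ).gate x) ((moe ψ θ').gate x) := by
    refine ⟨fun l k => ⟨mul_nonneg (hw _) ((hQ l.1).1 _ _).1,
      mul_le_one₀ (hwle _) ((hQ l.1).1 _ _).1 ((hQ l.1).1 _ _).2⟩, fun l => ?_, fun k => ?_⟩
    · rw [← Finset.mul_sum, (hQ l.1).2.1]; rfl
    · rw [Fintype.sum_prod_type]
      simp only [← Finset.mul_sum, (hQ _).2.2, ← Finset.sum_mul, hw1, one_mul]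
  refine (iInf₂_le _ hplan).trans (ENNReal.ofReal_le_ofReal ?_)
  rw [Fintype.sum_prod_type]
  refine Finset.sum_le_sum fun m _ => Finset.sum_le_sum fun k _ => ?_
  have hterm : ∀ j, w m * Q m k j * c ((moe ψ (θ m)).expert x k) ((moe ψ θ').expert x j) ≤
      (if k = j then c ((moe ψ (θ m)).expert x k) ((moe ψ θ').expert x k) else 0) +
      |(moe ψ (θ m)).gate x k - (moe ψ θ').gate x k| *
        c ((moe ψ (θ m)).expert x k) ((moe ψ θ').expert x j) := by
    intro j
    have h0 := ((hQ m).1 k j).1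
    have hQw : w m * Q m k j ≤ Q m k j := mul_le_of_le_one_left h0 (hwle m)
    split_ifs with hkj
    · subst hkj
      have h1 : w m * Q m k k ≤ 1 := hQw.trans ((hQ m).1 k k).2
      have h2 := mul_le_of_le_one_left (hcn m k k) h1
      have h3 := mul_nonneg (abs_nonneg ((moe ψ (θ m)).gate x k - (moe ψ θ').gate x k))
        (hcn m k k)
      linarith
    · rw [zero_add]
      exact mul_le_mul_of_nonneg_right (hQw.trans (hQoff m k j hkj)) (hcn m k j)
  refine (Finset.sum_le_sum fun j _ => hterm j).trans ?_
  rw [Finset.sum_add_distrib]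
  simp

/-- Gate differences are at most `1`, so each of the `J + 1` labels contributes at most `G + (J + 1)
* G`. This supplies the dominating function. -/
theorem couplingBound_le (hc : IsCost (Set.range ψ) c) {θ θ' : MoEParam d J R S} {x : Fin d → ℝ}
    {G : ℝ} (hG : ∀ j k, c ((moe ψ θ).expert x j) ((moe ψ θ').expert x k) ≤ G) :
    couplingBound ψ c θ θ' x ≤ (J + 1) * (J + 2) * G := by
  have h1 : ∀ k, |(moe ψ θ).gate x k - (moe ψ θ').gate x k| ≤ 1 := fun k => by
    have h1 := moe_gate_pos (ψ := ψ) θ x k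
    have h2 := moe_gate_pos (ψ := ψ) θ' x k
    have h3 := moe_gate_le_one (ψ := ψ) θ x k
    have h4 := moe_gate_le_one (ψ := ψ) θ' x k
    rw [abs_le]; constructor <;> linarith
  have h2 : ∀ k, (c ((moe ψ θ).expert x k) ((moe ψ θ').expert x k) +
      ∑ j, |(moe ψ θ).gate x k - (moe ψ θ').gate x k| *
        c ((moe ψ θ).expert x k) ((moe ψ θ').expert x j)) ≤ G + ∑ _j : Fin (J + 1), G := by
    refine fun k => add_le_add (hG k k) (Finset.sum_le_sum fun j _ => ?_)
    exact (mul_le_of_le_one_left (hc.nonneg _ (moe_expert_mem_range _ _ _) _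
      (moe_expert_mem_range _ _ _)) (h1 k)).trans (hG k j)
  refine (Finset.sum_le_sum fun k _ => h2 k).trans (le_of_eq ?_)
  simp only [Finset.sum_const, Finset.card_univ, Fintype.card_fin, nsmul_eq_mul]
  push_cast
  ring

variable [TopologicalSpace 𝒴] [OpensMeasurableSpace 𝒴] [TopologicalSpace S]

/-- Joint continuity serves twice: for measurability in `x` and for pointwise convergence in the
parameter. -/
theorem continuous_couplingBound (hψ : Continuous ψ)
    (hcont : IsDistributionallyContinuousCost (Set.range ψ) c) (θ' : MoEParam d J R S) :
    Continuous fun p : MoEParam d J R S × (Fin d → ℝ) => couplingBound ψ c p.1 θ' p.2 := by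
  have hg : ∀ k, Continuous fun p : MoEParam d J R S × (Fin d → ℝ) => (moe ψ θ').gate p.2 k :=
    fun k => (continuous_moe_gate k).comp (continuous_const.prodMk continuous_snd)
  have hcc : ∀ k j, Continuous fun p : MoEParam d J R S × (Fin d → ℝ) =>
      c ((moe ψ p.1).expert p.2 k) ((moe ψ θ').expert p.2 j) := fun k j =>
    hcont.continuous_comp (continuous_moe_expert hψ k)
      ((continuous_moe_expert hψ j).comp (continuous_const.prodMk continuous_snd))
      (fun _ => moe_expert_mem_range _ _ _) (fun _ => moe_expert_mem_range _ _ _)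
  exact continuous_finsetSum _ fun k _ => (hcc k k).add (continuous_finsetSum _ fun j _ =>
    (((continuous_moe_gate k).sub (hg k)).abs).mul (hcc k j))

/-- The expected transportation divergence from weighted averages of converging models to the limit
model vanishes in the limit, for arbitrary weights. -/
theorem tendsto_transportDiv_weightedAverage (hψ : Continuous ψ) (hc : IsCost (Set.range ψ) c)
    (hcont : IsDistributionallyContinuousCost (Set.range ψ) c) {μ : Measure (Fin d → ℝ)}
    {θ' : MoEParam d J R S} (henv : HasIntegrableEnvelope ψ c μ θ') {w : ℕ → Fin M → ℝ}
    (hw : ∀ n m, 0 ≤ w n m) (hw1 : ∀ n, ∑ m, w n m = 1) {θ : ℕ → Fin M → MoEParam d J R S}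
    (hθ : ∀ m, Tendsto (fun n => θ n m) atTop (𝓝 θ')) :
    Tendsto (fun n => transportDiv c μ (weightedAverage ψ (w n) (θ n)) (moe ψ θ')) atTop
      (𝓝 0) := by
  obtain ⟨U, hU, G, hG, hbound⟩ := henv
  have hcb := continuous_couplingBound (J := J) hψ hcont θ'
  set f : ℕ → (Fin d → ℝ) → ℝ≥0∞ := fun n x =>
    ∑ m, ENNReal.ofReal (couplingBound ψ c (θ n m) θ' x) with hf
  have hlim : Tendsto (fun n => ∫⁻ x, f n x ∂μ) atTop (𝓝 0) := by
    suffices h : ∀ m, Tendsto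
        (fun n => ∫⁻ x, ENNReal.ofReal (couplingBound ψ c (θ n m) θ' x) ∂μ) atTop (𝓝 0) by
      have hmeas : ∀ n m, Measurable fun x =>
          ENNReal.ofReal (couplingBound ψ c (θ n m) θ' x) := fun n m =>
        (hcb.comp (continuous_const.prodMk continuous_id)).measurable.ennreal_ofReal
      simp only [hf]
      simp_rw [lintegral_finsetSum _ fun m _ => hmeas _ m]
      simpa using tendsto_finsetSum Finset.univ fun m _ => h m
    intro m
    have h0 : ∫⁻ _x : Fin d → ℝ, (0 : ℝ≥0∞) ∂μ = 0 := lintegral_zero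
    rw [← h0]
    -- The envelope holds only in `U`, so the terms before the sequence enters `U` for good are
    -- dropped.
    obtain ⟨n₀, hn₀⟩ := eventually_atTop.1 ((hθ m).eventually hU)
    rw [← tendsto_add_atTop_iff_nat n₀]
    refine tendsto_lintegral_of_dominated_convergence
      (fun x => ENNReal.ofReal ((J + 1) * (J + 2) * G x)) (fun n => ?_) (fun n => ?_) ?_ ?_
    · exact (hcb.comp (continuous_const.prodMk continuous_id)).measurable.ennreal_ofReal
    · filter_upwards [hbound] with x hx
      exact ENNReal.ofReal_le_ofReal (couplingBound_le hc (hx _ (hn₀ _ (Nat.le_add_left _ _))))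
    · exact (hG.const_mul _).lintegral_lt_top.ne
    · refine .of_forall fun x => ?_
      have h1 : Tendsto (fun n => couplingBound ψ c (θ n m) θ' x) atTop
          (𝓝 (couplingBound ψ c θ' θ' x)) :=
        ((hcb.comp (continuous_id.prodMk continuous_const)).tendsto θ').comp (hθ m)
      rw [couplingBound_self hc] at h1
      simpa using ENNReal.tendsto_ofReal ((tendsto_add_atTop_iff_nat n₀).2 h1)
  refine tendsto_of_tendsto_of_tendsto_of_le_of_le tendsto_const_nhds hlim (fun _ => zero_le)
    fun n => lintegral_mono fun x => ?_
  refine (transportDivAt_weightedAverage_le hc (hw n) (hw1 n) (θ n) θ' x).trans (le_of_eq ?_)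
  exact ENNReal.ofReal_sum_of_nonneg fun m _ => couplingBound_nonneg hc _ _ _

end

/-! ### Lower bound: from summable divergences to pointwise limits -/

/-- If expected transportation divergences are summable, the costs of moving the excess mass of a
set of sources over a set of targets vanish almost everywhere in the limit. -/
theorem ae_tendsto_excess_mul_inf {𝓧 𝒴 ι κ : Type*} [MeasurableSpace 𝓧] [MeasurableSpace 𝒴]
    [Fintype ι] [Fintype κ] [DecidableEq κ]
    {c : ProbabilityMeasure 𝒴 → ProbabilityMeasure 𝒴 → ℝ} {μ : Measure 𝓧} {h : ℕ → MoE 𝓧 𝒴 ι}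
    {g : ℕ → MoE 𝓧 𝒴 κ} (hc : ∀ n x l k, 0 ≤ c ((h n).expert x l) ((g n).expert x k))
    (hh : ∀ n l, Measurable fun x => (h n).gate x l)
    (hg : ∀ n k, Measurable fun x => (g n).gate x k)
    (hcm : ∀ n l k, Measurable fun x => c ((h n).expert x l) ((g n).expert x k))
    (hsum : ∑' n, transportDiv c μ (h n) (g n) ≠ ∞) (s : Finset ι) (t : Finset κ) :
    ∀ᵐ x ∂μ, Tendsto (fun n =>
      ENNReal.ofReal (∑ l ∈ s, (h n).gate x l - ∑ k ∈ t, (g n).gate x k) *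
        (s ×ˢ tᶜ).inf (fun p => ENNReal.ofReal (c ((h n).expert x p.1) ((g n).expert x p.2))))
      atTop (𝓝 0) := by
  set f : ℕ → 𝓧 → ℝ≥0∞ := fun n x =>
    ENNReal.ofReal (∑ l ∈ s, (h n).gate x l - ∑ k ∈ t, (g n).gate x k) *
      (s ×ˢ tᶜ).inf (fun p => ENNReal.ofReal (c ((h n).expert x p.1) ((g n).expert x p.2)))
  have hf : ∀ n, Measurable (f n) := by
    intro n
    refine Measurable.mul (Measurable.ennreal_ofReal
      ((Finset.measurable_fun_sum _ fun l _ => hh n l).sub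
        (Finset.measurable_fun_sum _ fun k _ => hg n k))) ?_
    simp only [Finset.inf_eq_iInf]
    exact Measurable.biInf _ (Finset.countable_toSet _) fun p _ => (hcm n p.1 p.2).ennreal_ofReal
  -- By Tonelli the series of excess costs is integrable, hence finite almost everywhere, and the
  -- terms of a convergent series vanish.
  have hfin : ∫⁻ x, ∑' n, f n x ∂μ ≠ ∞ := by
    rw [lintegral_tsum fun n => (hf n).aemeasurable]
    refine ne_top_of_le_ne_top hsum (ENNReal.tsum_le_tsum fun n => lintegral_mono fun x => ?_)
    exact ofReal_excess_mul_inf_le_transportDivAt (hc n x) s t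
  filter_upwards [ae_lt_top (.tsum hf) hfin] with x hx
  exact ENNReal.tendsto_atTop_zero_of_tsum_ne_top hx.ne

/-- Averages of functions with a common limit, with varying weights, have the same limit. -/
theorem tendsto_sum_weights_mul {M : ℕ} {w f : ℕ → Fin M → ℝ} {a : ℝ}
    (hw : ∀ n m, 0 ≤ w n m) (hw1 : ∀ n, ∑ m, w n m = 1) {F : Filter ℕ}
    (hf : ∀ m, Tendsto (fun n => f n m) F (𝓝 a)) :
    Tendsto (fun n => ∑ m, w n m * f n m) F (𝓝 a) := by
  rw [tendsto_iff_dist_tendsto_zero]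
  have h0 : Tendsto (fun n => ∑ m, dist (f n m) a) F (𝓝 0) := by
    simpa using tendsto_finsetSum Finset.univ fun m _ => tendsto_iff_dist_tendsto_zero.1 (hf m)
  refine squeeze_zero (fun _ => dist_nonneg) (fun n => ?_) h0
  have hwle : ∀ m, w n m ≤ 1 := fun m =>
    hw1 n ▸ Finset.single_le_sum (fun j _ => hw n j) (Finset.mem_univ m)
  have h1 : ∑ m, w n m * f n m - a = ∑ m, w n m * (f n m - a) := by
    simp only [mul_sub, Finset.sum_sub_distrib, ← Finset.sum_mul, hw1, one_mul]
  rw [Real.dist_eq, h1]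
  refine (Finset.abs_sum_le_sum_abs _ _).trans (Finset.sum_le_sum fun m _ => ?_)
  rw [abs_mul, abs_of_nonneg (hw n m), Real.dist_eq]
  exact mul_le_of_le_one_left (abs_nonneg _) (hwle m)

/-- Weight vectors of total mass one are close as soon as one does not exceed the other much. -/
theorem tendsto_of_tendsto_excess {ι Z : Type*} [Fintype ι] {F : Filter Z} {a b : Z → ι → ℝ}
    {p : ι → ℝ} (ha1 : ∀ z, ∑ i, a z i = 1) (hb1 : ∀ z, ∑ i, b z i = 1)
    (ha : ∀ i, Tendsto (fun z => a z i) F (𝓝 (p i)))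
    (h : ∀ i, Tendsto (fun z => ENNReal.ofReal (a z i - b z i)) F (𝓝 0)) (i : ι) :
    Tendsto (fun z => b z i) F (𝓝 (p i)) := by
  classical
  have hpos : ∀ i, Tendsto (fun z => max (a z i - b z i) 0) F (𝓝 0) := fun i => by
    have := (ENNReal.tendsto_toReal ENNReal.zero_ne_top).comp (h i)
    simpa [Function.comp_def, ENNReal.toReal_ofReal'] using this
  have hsum : Tendsto (fun z => ∑ i, max (a z i - b z i) 0) F (𝓝 0) := by
    simpa using tendsto_finsetSum Finset.univ fun i _ => hpos i
  have hdiff : Tendsto (fun z => b z i - a z i) F (𝓝 0) := by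
    refine squeeze_zero_norm (fun z => ?_) hsum
    have hle : ∀ j, a z j - b z j ≤ max (a z j - b z j) 0 := fun j => le_max_left _ _
    have hnn : ∀ j, 0 ≤ max (a z j - b z j) 0 := fun j => le_max_right _ _
    -- Both totals are `1`, so a deficit at `i` is compensated by excesses elsewhere: the sum of
    -- positive parts controls both signs.
    have h1 : a z i - b z i + ∑ j ∈ Finset.univ.erase i, (a z j - b z j) = 0 := by
      rw [Finset.add_sum_erase _ (fun j => a z j - b z j) (Finset.mem_univ i),
        Finset.sum_sub_distrib, ha1, hb1, sub_self]
    have h2 := Finset.sum_le_sum fun j (_ : j ∈ Finset.univ.erase i) => hle j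
    have h3 := Finset.sum_nonneg fun j (_ : j ∈ Finset.univ.erase i) => hnn j
    rw [← Finset.add_sum_erase _ _ (Finset.mem_univ i), Real.norm_eq_abs, abs_le]
    constructor <;> linarith [hle i, hnn i]
  simpa using hdiff.add (ha i)

/-- Used in both directions on a product of mass and cost: mass bounded below forces the cost to
vanish, and cost bounded below forces the excess mass to vanish. -/
theorem ENNReal.tendsto_zero_of_mul_tendsto_zero {Z : Type*} {F : Filter Z} {f g : Z → ℝ≥0∞}
    {p : ℝ≥0∞} (hp : 0 < p) (hf : ∀ᶠ z in F, p ≤ f z)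
    (h : Tendsto (fun z => f z * g z) F (𝓝 0)) : Tendsto g F (𝓝 0) := by
  rcases eq_or_ne p ∞ with rfl | hpt
  · refine tendsto_of_tendsto_of_tendsto_of_le_of_le' tendsto_const_nhds h
      (.of_forall fun _ => zero_le) ?_
    filter_upwards [hf] with z hz
    rw [top_le_iff.1 hz]
    exact le_mul_of_one_le_left' le_top
  · have h1 := ENNReal.Tendsto.const_mul (a := p⁻¹) h (Or.inr (ENNReal.inv_ne_top.2 hp.ne'))
    rw [mul_zero] at h1
    refine tendsto_of_tendsto_of_tendsto_of_le_of_le' tendsto_const_nhds h1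
      (.of_forall fun _ => zero_le) ?_
    filter_upwards [hf] with z hz
    calc g z = p⁻¹ * (p * g z) := by rw [← mul_assoc, ENNReal.inv_mul_cancel hp.ne' hpt, one_mul]
      _ ≤ _ := by gcongr

/-- The excess, over the mass of the targets in `t`, of the mass that the `k`-th experts of the
weighted average carry, times the least cost of moving it to a target outside `t`. -/
noncomputable def componentExcessCost {d J R M : ℕ} {S 𝒴 : Type*} [MeasurableSpace 𝒴]
    (ψ : (Fin R → ℝ) × S → ProbabilityMeasure 𝒴)
    (c : ProbabilityMeasure 𝒴 → ProbabilityMeasure 𝒴 → ℝ) (w : Fin M → ℝ)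
    (θ : Fin M → MoEParam d J R S) (η : MoEParam d J R S) (x : Fin d → ℝ)
    (k : Fin (J + 1)) (t : Finset (Fin (J + 1))) : ℝ≥0∞ :=
  ENNReal.ofReal (∑ m, w m * (moe ψ (θ m)).gate x k - ∑ j ∈ t, (moe ψ η).gate x j) *
    ((Finset.univ : Finset (Fin M)) ×ˢ tᶜ).inf fun p =>
      ENNReal.ofReal (c ((moe ψ (θ p.1)).expert x k) ((moe ψ η).expert x p.2))

theorem tendsto_moe_gate {d J R : ℕ} {S 𝒴 : Type*} [MeasurableSpace 𝒴] [TopologicalSpace S]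
    {ψ : (Fin R → ℝ) × S → ProbabilityMeasure 𝒴} {θstar : MoEParam d J R S} {Z : Type*} {F : Filter Z} {θ : Z → MoEParam d J R S}
    (hθ : Tendsto θ F (𝓝 θstar)) (x : Fin d → ℝ) (k : Fin (J + 1)) :
    Tendsto (fun n => (moe ψ (θ n)).gate x k) F (𝓝 ((moe ψ θstar).gate x k)) :=
  (((continuous_moe_gate (ψ := ψ) k).comp
    (continuous_id.prodMk (continuous_const (y := x)))).tendsto θstar).comp hθ

section

variable {d J R M : ℕ} {S 𝒴 : Type*} [MeasurableSpace 𝒴] [TopologicalSpace 𝒴]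
  [OpensMeasurableSpace 𝒴] [TopologicalSpace S]
  {ψ : (Fin R → ℝ) × S → ProbabilityMeasure 𝒴}
  {c : ProbabilityMeasure 𝒴 → ProbabilityMeasure 𝒴 → ℝ}

/-- The sources are the copies of expert `k` on all machines. Their total mass tends to the true
gate even if the weight of an individual machine vanishes. -/
theorem ae_tendsto_componentExcessCost (hψ : Continuous ψ) (hc : IsCost (Set.range ψ) c)
    (hcont : IsDistributionallyContinuousCost (Set.range ψ) c) {μ : Measure (Fin d → ℝ)}
    {w : ℕ → Fin M → ℝ} {θ : ℕ → Fin M → MoEParam d J R S} {η : ℕ → MoEParam d J R S}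
    (hsum : ∑' n, transportDiv c μ (weightedAverage ψ (w n) (θ n)) (moe ψ (η n)) ≠ ∞)
    (k : Fin (J + 1)) (t : Finset (Fin (J + 1))) :
    ∀ᵐ x ∂μ, Tendsto (fun n => componentExcessCost ψ c (w n) (θ n) (η n) x k t) atTop (𝓝 0) := by
  have hgate : ∀ (θ : MoEParam d J R S) k, Measurable fun x => (moe ψ θ).gate x k := fun θ k =>
    ((continuous_moe_gate k).comp (continuous_const.prodMk continuous_id)).measurable
  have hexp : ∀ (θ : MoEParam d J R S) k, Continuous fun x => (moe ψ θ).expert x k := fun θ k =>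
    (continuous_moe_expert hψ k).comp (continuous_const.prodMk continuous_id)
  have := ae_tendsto_excess_mul_inf (μ := μ) (h := fun n => weightedAverage ψ (w n) (θ n))
    (g := fun n => moe ψ (η n)) (c := c)
    (fun n x l k => hc.nonneg _ (moe_expert_mem_range _ _ _) _ (moe_expert_mem_range _ _ _))
    (fun n l => (hgate (θ n l.1) l.2).const_mul _) (fun n k => hgate _ k)
    (fun n l k => (hcont.continuous_comp (hexp _ _) (hexp _ _)
      (fun _ => moe_expert_mem_range _ _ _) (fun _ => moe_expert_mem_range _ _ _)).measurable)
    hsum (Finset.univ ×ˢ {k}) t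
  filter_upwards [this] with x hx
  refine (tendsto_congr fun n => ?_).2 hx
  rw [componentExcessCost, Finset.sum_product]
  simp only [Finset.sum_singleton]
  congr 1
  refine le_antisymm (Finset.le_inf fun p hp => ?_) (Finset.le_inf fun p hp => ?_)
  · simp only [Finset.mem_product, Finset.mem_univ, Finset.mem_singleton, true_and] at hp
    obtain ⟨rfl, hp2⟩ := hp
    exact Finset.inf_le (f := fun q : Fin M × Fin (J + 1) => ENNReal.ofReal
      (c ((moe ψ (θ n q.1)).expert x p.1.2) ((moe ψ (η n)).expert x q.2)))
      (b := (p.1.1, p.2)) (by simpa using hp2)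
  · exact Finset.inf_le (f := fun q : (Fin M × Fin (J + 1)) × Fin (J + 1) => ENNReal.ofReal
      (c ((weightedAverage ψ (w n) (θ n)).expert x q.1) ((moe ψ (η n)).expert x q.2)))
      (b := ((p.1, k), p.2)) (by simpa using hp)

/-! ### Convergence of experts and gates at a fixed covariate -/

variable {θstar : MoEParam d J R S} {w : ℕ → Fin M → ℝ} {θ : ℕ → Fin M → MoEParam d J R S}
  {η : ℕ → MoEParam d J R S}

theorem tendsto_moe_expert (hψ : Continuous ψ) {Z : Type*} {F : Filter Z}
    {θ : Z → MoEParam d J R S} (hθ : Tendsto θ F (𝓝 θstar)) (x : Fin d → ℝ) (k : Fin (J + 1)) :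
    Tendsto (fun n => (moe ψ (θ n)).expert x k) F (𝓝 ((moe ψ θstar).expert x k)) :=
  (((continuous_moe_expert hψ k).comp
    (continuous_id.prodMk (continuous_const (y := x)))).tendsto θstar).comp hθ

/-- If transportation costs vanish, every expert of the limit model is a limit of experts. -/
theorem exists_tendsto_expert (hψ : Continuous ψ) (hc : IsCost (Set.range ψ) c)
    (hcont : IsDistributionallyContinuousCost (Set.range ψ) c)
    (hw : ∀ n m, 0 ≤ w n m) (hw1 : ∀ n, ∑ m, w n m = 1)
    (hθ : ∀ m, Tendsto (fun n => θ n m) atTop (𝓝 θstar)) {F : Ultrafilter ℕ}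
    (hF : (F : Filter ℕ) ≤ atTop) {x : Fin d → ℝ} {k : Fin (J + 1)}
    (hx : Tendsto (fun n => componentExcessCost ψ c (w n) (θ n) (η n) x k ∅) atTop (𝓝 0)) :
    ∃ j, Tendsto (fun n => (moe ψ (η n)).expert x j) F (𝓝 ((moe ψ θstar).expert x k)) := by
  have hM : Nonempty (Fin M) := by
    by_contra h
    have := not_nonempty_iff.1 h
    simpa using hw1 0
  simp only [componentExcessCost, Finset.sum_empty, sub_zero] at hx
  -- With `t = ∅` nothing is subtracted from the mass, whose limit is the positive true gate; so the
  -- least cost tends to zero.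
  have ha := tendsto_sum_weights_mul (F := atTop) hw hw1
    (fun m => tendsto_moe_gate (ψ := ψ) (hθ m) x k)
  have hpos := moe_gate_pos (ψ := ψ) θstar x k
  have hI := ENNReal.tendsto_zero_of_mul_tendsto_zero (ENNReal.ofReal_pos.2 (half_pos hpos))
    (by
      filter_upwards [ha.eventually_const_lt (half_lt_self hpos)] with n hn
      exact ENNReal.ofReal_le_ofReal hn.le) hx
  choose q _ hq2 using fun n => Finset.exists_mem_eq_inf
    ((Finset.univ : Finset (Fin M)) ×ˢ (∅ : Finset (Fin (J + 1)))ᶜ) (by simp)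
    (fun p => ENNReal.ofReal (c ((moe ψ (θ n p.1)).expert x k) ((moe ψ (η n)).expert x p.2)))
  simp only [hq2] at hI
  have hcz : Tendsto (fun n =>
      c ((moe ψ (θ n (q n).1)).expert x k) ((moe ψ (η n)).expert x (q n).2)) atTop (𝓝 0) := by
    have := (ENNReal.tendsto_toReal ENNReal.zero_ne_top).comp hI
    refine (tendsto_congr fun n => ?_).1 this
    exact ENNReal.toReal_ofReal
      (hc.nonneg _ (moe_expert_mem_range _ _ _) _ (moe_expert_mem_range _ _ _))
  -- The minimizing machine varies with `n`, but all of the finitely many machines share the same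
  -- limit.
  have hu : Tendsto (fun n => (moe ψ (θ n (q n).1)).expert x k) atTop
      (𝓝 ((moe ψ θstar).expert x k)) := by
    intro U hU
    have : ∀ᶠ n in atTop, ∀ m, (moe ψ (θ n m)).expert x k ∈ U :=
      eventually_all.2 fun m => tendsto_moe_expert hψ (hθ m) x k hU
    exact this.mono fun n hn => hn _
  have hv := (hcont.tendsto_zero_iff _ _ _ (fun _ => moe_expert_mem_range _ _ _)
    (fun _ => moe_expert_mem_range _ _ _) (moe_expert_mem_range _ _ _) hu).1 hcz
  -- The minimizing label takes finitely many values, so it is constant on a set of the ultrafilter.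
  obtain ⟨j, hj⟩ := (Ultrafilter.eventually_exists_iff (f := F)
    (P := fun j n => (q n).2 = j)).1 (.of_forall fun n => ⟨_, rfl⟩)
  refine ⟨j, (hv.mono_left hF).congr' ?_⟩
  filter_upwards [hj] with n hn
  rw [hn]

/-- If transportation costs vanish and experts converge to pairwise distinct laws, then so do the
gating functions. -/
theorem tendsto_gate_of_tendsto_expert (hψ : Continuous ψ) (hc : IsCost (Set.range ψ) c)
    (hcont : IsDistributionallyContinuousCost (Set.range ψ) c)
    (hw : ∀ n m, 0 ≤ w n m) (hw1 : ∀ n, ∑ m, w n m = 1)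
    {F : Filter ℕ} (hθ : ∀ m, Tendsto (fun n => θ n m) F (𝓝 θstar)) {x : Fin d → ℝ}
    (hinj : Function.Injective ((moe ψ θstar).expert x))
    (hη : ∀ k, Tendsto (fun n => (moe ψ (η n)).expert x k) F (𝓝 ((moe ψ θstar).expert x k)))
    (hx : ∀ k, Tendsto (fun n => componentExcessCost ψ c (w n) (θ n) (η n) x k {k}) F (𝓝 0))
    (k : Fin (J + 1)) :
    Tendsto (fun n => (moe ψ (η n)).gate x k) F (𝓝 ((moe ψ θstar).gate x k)) := by
  refine tendsto_of_tendsto_excess (a := fun n k => ∑ m, w n m * (moe ψ (θ n m)).gate x k)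
    (fun n => ?_) (fun n => moe_gate_sum _ _)
    (fun k => tendsto_sum_weights_mul hw hw1 fun m => tendsto_moe_gate (hθ m) x k)
    (fun k => ?_) k
  · rw [Finset.sum_comm]
    simp only [← Finset.mul_sum, moe_gate_sum, mul_one, hw1]
  have hxk := hx k
  simp only [componentExcessCost, Finset.sum_singleton] at hxk
  have hpos : ∀ j, 0 < (if j = k then (1 : ℝ) else
      c ((moe ψ θstar).expert x k) ((moe ψ θstar).expert x j)) := fun j => by
    split_ifs with hj
    · exact one_pos
    · refine (hc.nonneg _ (moe_expert_mem_range _ _ _) _ (moe_expert_mem_range _ _ _)).lt_of_ne'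
        fun h => hj ?_
      exact (hinj ((hc.eq_zero_iff _ (moe_expert_mem_range _ _ _) _
        (moe_expert_mem_range _ _ _)).1 h)).symm
  obtain ⟨j₀, hj₀⟩ := Finite.exists_min fun j => (if j = k then (1 : ℝ) else
      c ((moe ψ θstar).expert x k) ((moe ψ θstar).expert x j))
  set δ := (if j₀ = k then (1 : ℝ) else
      c ((moe ψ θstar).expert x k) ((moe ψ θstar).expert x j₀)) with hδ
  have hev : ∀ᶠ n in F, ∀ m j, j ≠ k →
      δ / 2 ≤ c ((moe ψ (θ n m)).expert x k) ((moe ψ (η n)).expert x j) := by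
    refine eventually_all.2 fun m => eventually_all.2 fun j => ?_
    by_cases hj : j = k
    · exact .of_forall fun n h => absurd hj h
    have hlim := hcont.tendsto (fun _ => moe_expert_mem_range _ _ _)
      (fun _ => moe_expert_mem_range _ _ _) (moe_expert_mem_range _ _ _)
      (moe_expert_mem_range _ _ _) (tendsto_moe_expert hψ (hθ m) x k) (hη j)
    have hlt : δ / 2 < c ((moe ψ θstar).expert x k) ((moe ψ θstar).expert x j) := by
      have h1 := hj₀ j
      rw [if_neg hj] at h1
      exact (half_lt_self (hpos j₀)).trans_le h1
    filter_upwards [hlim.eventually_const_lt hlt] with n hn _ using hn.le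
  -- Leaving label `k` eventually costs at least `δ / 2`, so the excess mass of `k` must vanish.
  refine ENNReal.tendsto_zero_of_mul_tendsto_zero (p := ENNReal.ofReal (δ / 2))
    (ENNReal.ofReal_pos.2 (half_pos (hpos j₀))) ?_ (hxk.congr fun n => mul_comm _ _)
  filter_upwards [hev] with n hn
  refine Finset.le_inf fun p hp => ENNReal.ofReal_le_ofReal (hn _ _ ?_)
  simpa using hp

end

/-! ### Identification of the parameters -/

/-- A set of full measure without finitely many hyperplanes is not contained in a hyperplane. -/
theorem NotOnHyperplanes.exists_dotProduct_ne_zero {d : ℕ} {μ : Measure (Fin d → ℝ)}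
    (hμ : NotOnHyperplanes μ) {p : (Fin d → ℝ) → Prop} (hp : ∀ᵐ x ∂μ, p x)
    (H : Finset (Fin (d + 1) → ℝ)) (hH : ∀ u ∈ H, u ≠ 0) :
    ∃ x, p x ∧ ∀ u ∈ H, u ⬝ᵥ augment x ≠ 0 := by
  by_contra! h
  exact hμ H hH (hp.mono h)

/-- Outside finitely many hyperplanes, distinct experts have distinct laws. -/
theorem exists_hyperplanes_expert_injective {d J R : ℕ} {S 𝒴 : Type*} [MeasurableSpace 𝒴]
    {ψ : (Fin R → ℝ) × S → ProbabilityMeasure 𝒴} (hψ : Function.Injective ψ) {θ : MoEParam d J R S}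
    (hθ : Function.Injective θ.2) :
    ∃ H : Finset (Fin (d + 1) → ℝ), (∀ u ∈ H, u ≠ 0) ∧
      ∀ x, (∀ u ∈ H, u ⬝ᵥ augment x ≠ 0) → Function.Injective ((moe ψ θ).expert x) := by
  classical
  -- Equal laws at `x` have equal predictors, so every nonzero difference of coefficient vectors is
  -- orthogonal to `augment x`. Zero differences define no hyperplane and are erased.
  refine ⟨(Finset.univ.image fun p : Fin (J + 1) × Fin (J + 1) × Fin R =>
    (θ.2 p.1).1 p.2.2 - (θ.2 p.2.1).1 p.2.2).erase 0, fun u hu => Finset.ne_of_mem_erase hu,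
    fun x hx j k hjk => hθ ?_⟩
  have hjk' := hψ hjk
  simp only [Prod.mk.injEq] at hjk'
  refine Prod.ext (funext fun i => ?_) hjk'.2
  by_contra hne
  refine hx _ (Finset.mem_erase.2 ⟨sub_ne_zero.2 hne,
    Finset.mem_image_of_mem _ (Finset.mem_univ (j, k, i))⟩) ?_
  rw [sub_dotProduct, sub_eq_zero]
  exact congrFun hjk'.1 i

section

variable {d J R M : ℕ} {S 𝒴 : Type*} [MeasurableSpace 𝒴] [TopologicalSpace 𝒴]
  [OpensMeasurableSpace 𝒴] [TopologicalSpace S]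
  {ψ : (Fin R → ℝ) × S → ProbabilityMeasure 𝒴}
  {c : ProbabilityMeasure 𝒴 → ProbabilityMeasure 𝒴 → ℝ}

theorem IsOrdered.injective {r : ExpertParam d R S → ExpertParam d R S → Prop}
    [Std.Irrefl r] {θ : MoEParam d J R S} (h : IsOrdered r θ) : Function.Injective θ.2 := by
  have hlt : ∀ j k, j < k → θ.2 j ≠ θ.2 k := fun j k hjk heq => by
    have := (h j k hjk).self_of_nhds
    simp only [heq] at this
    exact irrefl _ this
  intro j k hjk
  by_contra hne
  rcases lt_or_gt_of_ne hne with h1 | h1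
  · exact hlt _ _ h1 hjk
  · exact hlt _ _ h1 hjk.symm

/-- Limits of labelled experts, up to relabelling, that are ordered, keep their labels. -/
theorem IsOrdered.relabelling_eq_id {r : ExpertParam d R S → ExpertParam d R S → Prop}
    [Std.Irrefl r] [T2Space S] {θstar : MoEParam d J R S} (h : IsOrdered r θstar) {Z : Type*}
    {F : Filter Z} [F.NeBot] {η : Z → MoEParam d J R S}
    (hlab : ∀ z j k, j < k → ¬ r ((η z).2 k) ((η z).2 j)) {σ : Fin (J + 1) → Fin (J + 1)}
    (hσ : ∀ k, Tendsto (fun z => (η z).2 (σ k)) F (𝓝 (θstar.2 k))) : σ = id := by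
  have hinj : Function.Injective σ := fun j k hjk =>
    h.injective (tendsto_nhds_unique (hσ j) (hjk ▸ hσ k))
  -- If `σ` inverted `j < k`, the order, being stable near the limits, would contradict the
  -- labelling of some `η z`. A strictly increasing self-map of `Fin (J + 1)` is the identity.
  have hmono : StrictMono σ := by
    intro j k hjk
    refine lt_of_le_of_ne (not_lt.1 fun hlt => ?_) (hinj.ne hjk.ne)
    obtain ⟨z, hz⟩ := (((hσ j).prodMk_nhds (hσ k)).eventually (h j k hjk)).exists
    exact hlab z _ _ hlt hz
  exact hmono.eq_id

/-- Experts whose laws converge at covariates that are not contained in a hyperplane converge. -/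
theorem tendsto_expertParam (hψ : IsEmbedding ψ) {θstar : MoEParam d J R S} {Z : Type*}
    {F : Filter Z} {η : Z → MoEParam d J R S} {j k : Fin (J + 1)} {E : Set (Fin d → ℝ)}
    (hE : ∀ u : Fin (d + 1) → ℝ, u ≠ 0 → ∃ x ∈ E, u ⬝ᵥ augment x ≠ 0)
    (h : ∀ x ∈ E, Tendsto (fun z => (moe ψ (η z)).expert x j) F
      (𝓝 ((moe ψ θstar).expert x k))) :
    Tendsto (fun z => (η z).2 j) F (𝓝 (θstar.2 k)) := by
  have h' : ∀ x ∈ E, Tendsto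
      (fun z => ((fun i => ((η z).2 j).1 i ⬝ᵥ augment x), ((η z).2 j).2)) F
      (𝓝 ((fun i => (θstar.2 k).1 i ⬝ᵥ augment x), (θstar.2 k).2)) := fun x hx =>
    hψ.isInducing.tendsto_nhds_iff.2 (h x hx)
  -- Only nonemptiness of `E` is extracted: the dispersion is read off at a single covariate.
  obtain ⟨x₀, hx₀, -⟩ := hE (Pi.single 0 1) (by simp)
  have hb : Tendsto (fun z => ((η z).2 j).1) F (𝓝 (θstar.2 k).1) := tendsto_pi_nhds.2 fun i =>
    tendsto_of_tendsto_dotProduct_augment hE fun x hx => tendsto_pi_nhds.1 (h' x hx).fst_nhds i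
  exact hb.prodMk_nhds (h' x₀ hx₀).snd_nhds

/-- If the expected transportation divergences from weighted averages of converging models are
summable, then the models with correctly labelled experts converge to the same parameter. -/
theorem tendsto_of_tsum_transportDiv_ne_top [T2Space S] (hψ : IsEmbedding ψ)
    (hc : IsCost (Set.range ψ) c) (hcont : IsDistributionallyContinuousCost (Set.range ψ) c)
    {μ : Measure (Fin d → ℝ)} (hμ : NotOnHyperplanes μ) {θstar : MoEParam d J R S}
    {r : ExpertParam d R S → ExpertParam d R S → Prop} [Std.Irrefl r] (hord : IsOrdered r θstar)
    {w : ℕ → Fin M → ℝ} (hw : ∀ n m, 0 ≤ w n m) (hw1 : ∀ n, ∑ m, w n m = 1)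
    {θ : ℕ → Fin M → MoEParam d J R S} (hθ : ∀ m, Tendsto (fun n => θ n m) atTop (𝓝 θstar))
    {η : ℕ → MoEParam d J R S} (hlab : ∀ n j k, j < k → ¬ r ((η n).2 k) ((η n).2 j))
    (hsum : ∑' n, transportDiv c μ (weightedAverage ψ (w n) (θ n)) (moe ψ (η n)) ≠ ∞)
    {F : Ultrafilter ℕ} (hF : (F : Filter ℕ) ≤ atTop) : Tendsto η F (𝓝 θstar) := by
  classical
  have hgood : ∀ᵐ x ∂μ, ∀ k t,
      Tendsto (fun n => componentExcessCost ψ c (w n) (θ n) (η n) x k t) atTop (𝓝 0) :=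
    ae_all_iff.2 fun k => ae_all_iff.2 fun t =>
      ae_tendsto_componentExcessCost hψ.continuous hc hcont hsum k t
  have hrelabel : ∃ σ : Fin (J + 1) → Fin (J + 1), ∀ u : Fin (d + 1) → ℝ, u ≠ 0 →
      ∃ x ∈ {x | ∀ k, Tendsto (fun n => (moe ψ (η n)).expert x (σ k)) F
        (𝓝 ((moe ψ θstar).expert x k))}, u ⬝ᵥ augment x ≠ 0 := by
    -- Pigeonhole over relabellings: otherwise the covariates served by each `σ` lie in a hyperplane
    -- with normal `u σ`. A good `x` off these finitely many hyperplanes has a relabelling of its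
    -- own, a contradiction.
    by_contra! hcon
    choose u hu0 hu using hcon
    obtain ⟨x, hx, hxu⟩ := hμ.exists_dotProduct_ne_zero hgood (Finset.univ.image u)
      (by simpa using hu0)
    choose σ hσ using fun k =>
      exists_tendsto_expert hψ.continuous hc hcont hw hw1 hθ hF (hx k ∅)
    exact hxu (u σ) (Finset.mem_image_of_mem _ (Finset.mem_univ σ)) (hu σ x hσ)
  obtain ⟨σ, hσ⟩ := hrelabel
  have hβσ : ∀ k, Tendsto (fun n => (η n).2 (σ k)) F (𝓝 (θstar.2 k)) := fun k =>
    tendsto_expertParam hψ hσ fun x hx => hx k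
  obtain rfl := hord.relabelling_eq_id hlab hβσ
  have hβ : Tendsto (fun n => (η n).2) F (𝓝 θstar.2) := tendsto_pi_nhds.2 hβσ
  obtain ⟨H, hH0, hH⟩ := exists_hyperplanes_expert_injective hψ.injective hord.injective
  -- The gates are tested at good covariates where the true experts have distinct laws. Removing the
  -- hyperplanes `H` leaves enough of them to determine linear forms.
  have hα : Tendsto (fun n => (η n).1) F (𝓝 θstar.1) := by
    refine tendsto_pi_nhds.2 fun i => tendsto_of_tendsto_dotProduct_augment
      (E := {x | (∀ k t, Tendsto
        (fun n => componentExcessCost ψ c (w n) (θ n) (η n) x k t) atTop (𝓝 0)) ∧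
        ∀ u ∈ H, u ⬝ᵥ augment x ≠ 0}) (fun u hu => ?_) fun x hx => ?_
    · obtain ⟨x, hx, hxu⟩ := hμ.exists_dotProduct_ne_zero hgood (insert u H)
        (Finset.forall_mem_insert _ _ _ |>.2 ⟨hu, hH0⟩)
      rw [Finset.forall_mem_insert] at hxu
      exact ⟨x, ⟨hx, hxu.2⟩, hxu.1⟩
    · have hexp : ∀ k, Tendsto (fun n => (moe ψ (η n)).expert x k) F
          (𝓝 ((moe ψ θstar).expert x k)) := fun k => by
        refine (hψ.continuous.tendsto _).comp (Tendsto.prodMk_nhds (tendsto_pi_nhds.2 fun i => ?_)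
          (hβσ k).snd_nhds)
        exact ((Continuous.dotProduct continuous_id continuous_const).tendsto _).comp
          (tendsto_pi_nhds.1 (hβσ k).fst_nhds i)
      have hgate := tendsto_gate_of_tendsto_expert hψ.continuous hc hcont hw hw1
        (fun m => (hθ m).mono_left hF) (hH x hx.2) hexp fun k => (hx.1 k {k}).mono_left hF
      have hlast := moe_gate_pos (ψ := ψ) θstar x (Fin.last J)
      have hi := moe_gate_pos (ψ := ψ) θstar x i.castSucc
      have hlog := ((hgate i.castSucc).div (hgate (Fin.last J)) hlast.ne').log
        (div_pos hi hlast).ne'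
      simpa only [Pi.div_apply, moe, log_softmax_div] using hlog
  exact hα.prodMk_nhds hβ

end

/-! ### From the deterministic statement to consistency -/

/-- Reductions of weighted averages of models with parameters close to the true one have parameters
close to the true one. -/
theorem exists_forall_isReduction_edist_lt {d J R M : ℕ} {S 𝒴 : Type*} [MeasurableSpace 𝒴]
    [TopologicalSpace 𝒴] [OpensMeasurableSpace 𝒴] [MetricSpace S]
    {ψ : (Fin R → ℝ) × S → ProbabilityMeasure 𝒴} (hψ : IsEmbedding ψ)
    {c : ProbabilityMeasure 𝒴 → ProbabilityMeasure 𝒴 → ℝ} (hc : IsCost (Set.range ψ) c)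
    (hcont : IsDistributionallyContinuousCost (Set.range ψ) c)
    {μ : Measure (Fin d → ℝ)} (hμ : NotOnHyperplanes μ) {θstar : MoEParam d J R S}
    {r : ExpertParam d R S → ExpertParam d R S → Prop} [Std.Irrefl r] (hord : IsOrdered r θstar)
    (henv : HasIntegrableEnvelope ψ c μ θstar) {ε : ℝ≥0∞} (hε : 0 < ε) :
    ∃ δ : ℝ≥0∞, 0 < δ ∧ ∀ (w : Fin M → ℝ) (θ : Fin M → MoEParam d J R S) (η : MoEParam d J R S),
      (∀ m, 0 ≤ w m) → ∑ m, w m = 1 → (∀ m, edist (θ m) θstar < δ) →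
      IsReduction ψ c μ r (weightedAverage ψ w θ) η → edist η θstar < ε := by
  by_contra! hcon
  have hpos : ∀ n : ℕ, (0 : ℝ≥0∞) < ((n : ℝ≥0∞) + 1)⁻¹ := fun n =>
    ENNReal.inv_pos.2 (ENNReal.add_ne_top.2 ⟨ENNReal.natCast_ne_top n, ENNReal.one_ne_top⟩)
  choose w θ η hw hw1 hθ hred hη using fun n => hcon _ (hpos n)
  have hδ : Tendsto (fun n : ℕ => ((n : ℝ≥0∞) + 1)⁻¹) atTop (𝓝 0) := by
    simpa [Function.comp_def] using
      ENNReal.tendsto_inv_nat_nhds_zero.comp (tendsto_add_atTop_nat 1)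
  have hθlim : ∀ m, Tendsto (fun n => θ n m) atTop (𝓝 θstar) := fun m =>
    tendsto_iff_edist_tendsto_0.2 (tendsto_of_tendsto_of_tendsto_of_le_of_le tendsto_const_nhds hδ
      (fun _ => zero_le) fun n => (hθ n m).le)
  have hT := tendsto_transportDiv_weightedAverage hψ.continuous hc hcont henv hw hw1 hθlim
  -- A subsequence along which the divergences to `θstar` are at most `e n`; by minimality those to
  -- the reductions are then summable.
  obtain ⟨e, he0, hesum⟩ := ENNReal.exists_pos_sum_of_countable' one_ne_zero ℕ
  obtain ⟨s, hs, hsT⟩ := extraction_forall_of_eventually fun n =>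
    hT.eventually_le_const (he0 n)
  have hlim := tendsto_of_tsum_transportDiv_ne_top (w := w ∘ s) (θ := θ ∘ s) (η := η ∘ s)
    hψ hc hcont hμ hord (fun n => hw _) (fun n => hw1 _)
    (fun m => (hθlim m).comp hs.tendsto_atTop) (fun n => (hred _).2)
    (ne_top_of_le_ne_top (hesum.trans ENNReal.one_lt_top).ne
      (ENNReal.tsum_le_tsum fun n => ((hred _).1 θstar).trans (hsT n)))
    Nat.hyperfilter_le_atTop
  -- Convergence along one ultrafilter finer than `atTop` suffices, since a single index within `ε`
  -- is contradictory.
  obtain ⟨n, hn⟩ := ((tendsto_iff_edist_tendsto_0.1 hlim).eventually_lt_const hε).exists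
  exact (hη (s n)).not_gt hn

/-- With the deterministic `δ`, the estimator is `ε`-far only if some local estimator is `δ`-far or
the reduction fails. These are finitely many events of vanishing probability, and subadditivity of
`P` requires no measurability of them. -/
theorem proposition3 {d J R M : ℕ}
    {𝒴 : Type*} [TopologicalSpace 𝒴] [TopologicalSpace.MetrizableSpace 𝒴]
    [MeasurableSpace 𝒴] [BorelSpace 𝒴]
    {S : Type*} [MetricSpace S]
    -- the family of experts, e.g. `gaussianExpert` or `softmaxExpert`
    (ψ : (Fin R → ℝ) × S → ProbabilityMeasure 𝒴) (hψ : IsEmbedding ψ)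
    -- the cost function on the family of expert laws
    (c : ProbabilityMeasure 𝒴 → ProbabilityMeasure 𝒴 → ℝ)
    (hc : IsCost (Set.range ψ) c)
    (hcont : IsDistributionallyContinuousCost (Set.range ψ) c)
    -- the law of the covariates
    (μ : Measure (Fin d → ℝ)) [IsProbabilityMeasure μ] (hμ : NotOnHyperplanes μ)
    -- the true parameter, with ordered experts
    (θstar : MoEParam d J R S)
    (r : ExpertParam d R S → ExpertParam d R S → Prop) [IsStrictOrder (ExpertParam d R S) r]
    (hord : IsOrdered r θstar)
    (henv : HasIntegrableEnvelope ψ c μ θstar)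
    -- i.i.d. data from the true model
    {Ω : Type*} [MeasurableSpace Ω] (P : Measure Ω) [IsProbabilityMeasure P]
    (X : ℕ → Ω → Fin d → ℝ) (Y : ℕ → Ω → 𝒴)
    (hX : ∀ i, Measurable (X i)) (hY : ∀ i, Measurable (Y i))
    (hindep : iIndepFun (fun i ω => (X i ω, Y i ω)) P)
    (hlaw : ∀ i, ∀ A : Set (Fin d → ℝ), ∀ B : Set 𝒴, MeasurableSet A → MeasurableSet B →
      P {ω | X i ω ∈ A ∧ Y i ω ∈ B} = ∫⁻ x in A, (moe ψ θstar).condLaw x B ∂μ)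
    -- distribution of the first `N` data over `M` machines (possibly at random)
    (D : ℕ → Ω → Fin M → Finset ℕ) (hD : ∀ N ω m, D N ω m ⊆ Finset.range N)
    (hDcard : ∀ N ω, ∑ m, (D N ω m).card = N)
    -- local estimators, functions of the local data, each of them consistent
    (est : ℕ → Fin M → (s : Finset ℕ) → (s → (Fin d → ℝ) × 𝒴) → MoEParam d J R S)
    (θhat : ℕ → Ω → Fin M → MoEParam d J R S)
    (hθhat : ∀ N ω m, θhat N ω m = est N m (D N ω m) fun i => (X i ω, Y i ω))
    (hcons : ∀ m, TendstoInMeasure P (fun N ω => θhat N ω m) atTop fun _ => θstar)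
    -- the reduction estimator, with weights `N_m / N`
    (θbar : ℕ → Ω → MoEParam d J R S)
    (hθbar : Tendsto (fun N => P {ω | ¬ IsReduction ψ c μ r
      (weightedAverage ψ (fun m => ((D N ω m).card : ℝ) / N) (θhat N ω)) (θbar N ω)})
      atTop (𝓝 0)) :
    TendstoInMeasure P θbar atTop fun _ => θstar := by
  intro ε hε
  obtain ⟨δ, hδ, hclose⟩ := exists_forall_isReduction_edist_lt (M := M) hψ hc hcont hμ hord henv hε
  have hlim : Tendsto (fun N => ∑ m, P {ω | δ ≤ edist (θhat N ω m) θstar} +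
      P {ω | ¬ IsReduction ψ c μ r
        (weightedAverage ψ (fun m => ((D N ω m).card : ℝ) / N) (θhat N ω)) (θbar N ω)})
      atTop (𝓝 0) := by
    simpa using (tendsto_finsetSum Finset.univ fun m _ => hcons m δ hδ).add hθbar
  refine tendsto_of_tendsto_of_tendsto_of_le_of_le' tendsto_const_nhds hlim
    (.of_forall fun _ => zero_le) ?_
  -- For `N = 0` the weights are `0 / 0 = 0` and do not sum to one.
  filter_upwards [eventually_gt_atTop 0] with N hN
  have hsub : {ω | ε ≤ edist (θbar N ω) θstar} ⊆
      (⋃ m, {ω | δ ≤ edist (θhat N ω m) θstar}) ∪ {ω | ¬ IsReduction ψ c μ r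
        (weightedAverage ψ (fun m => ((D N ω m).card : ℝ) / N) (θhat N ω)) (θbar N ω)} := by
    intro ω hω
    by_contra hout
    simp only [Set.mem_union, Set.mem_iUnion, Set.mem_ofPred_eq, not_or, not_exists, not_le,
      not_not] at hout
    refine hω.not_gt (hclose _ _ _ (fun m => by positivity) ?_ hout.1 hout.2)
    rw [← Finset.sum_div, ← Nat.cast_sum, hDcard, div_self (by positivity)]
  exact (measure_mono hsub).trans ((measure_union_le _ _).trans
    (by gcongr; exact measure_iUnion_fintype_le _ _))
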